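/- Let $w_1,\dots,w_n\ge 1$ and $d\ge 0$ be integers, put $|\alpha|=\sum_i w_i\alpha_i$ for $\alpha\in\mathbb N^n$, and let $f_0\in\mathbb C[x_1,\dots,x_n]$ be quasihomogeneous of type $(d;w_1,\dots,w_n)$ (every monomial $x^\alpha$ of $f_0$ has $|\alpha|=d$) with an isolated singularity at $0$. Let $x^\alpha$, $\alpha\in B$, be a monomial $\mathbb C$-basis of the Milnor algebra $\mathbb C\{x\}/(\partial f_0/\partial x_1,\dots,\partial f_0/\partial x_n)$ and let $m_1,\dots,m_k$ be the distinct monomials $x^\alpha$ with $\alpha\in B$, $|\alpha|>d$, in any order. Put $A_-=\mathbb C[t_1,\dots,t_k]$ and $F=f_0+\sum_{j=1}^k t_jm_j$, and let $A_-\{x\}$ be the ring of power series $\sum_\alpha a_\alpha(t)x^\alpha$ with coefficients $a_\alpha\in A_-$ that converge in a neighbourhood of $\{0\}\times\mathbb C^k$ in $\mathbb C^n\times\mathbb C^k$. Give $x_i$ the weight $w_i$ and $t_j$ the weight $d-\deg m_j<0$. Let $$I=A_-\{x\}\big/\Big(\tfrac{\partial F}{\partial x_1},\dots,\tfrac{\partial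 F}{\partial x_n}\Big)$$ be the relative Milnor algebra, and let $\mathcal L$ be the kernel of the Kodaira–Spencer map $$\rho:\operatorname{Der}_{\mathbb C}A_-\to (x)A_-\{x\}\Big/\Big((F)+(x)\big(\tfrac{\partial F}{\partial x_1},\dots,\tfrac{\partial F}{\partial x_n}\big)\Big),\qquad \rho(\delta)=\text{class of }\delta F=\sum_{j=1}^k\delta(t_j)m_j .$$ Then there are non-zero homogeneous elements $n_1,\dots,n_k\in A_-\{x\}$ such that each $n_iF$ has in $I$ a unique expression $n_iF=\sum_{j=1}^k h_{ij}m_j$ with $h_{ij}\in A_-$, and such that: 1. $h_{ij}=h_{k-j+1,\,k-i+1}$ for all $1\le i,j\le k$; 2. the vector fields $\delta_i=\sum_{j=1}^k h_{ij}\,\frac{\partial}{\partial t_j}$ are homogeneous of degree $\deg(n_i)$ (that is, $\delta_i$ maps homogeneous polynomials of degree $a$ to homogeneous polynomials of degree $a+\deg(n_i)$), and $\mathcal L=\sum_{i=1}^k A_-\delta_i$. -/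

import Mathlib

open scoped Topology

noncomputable section

namespace SemiQH

/-! ### Convergent power series -/

/-- Cauchy-type bound for the coefficients of a power series in `x₁, …, xₙ`. -/
def CoeffBound {n : ℕ} (r C : ℝ) (g : MvPowerSeries (Fin n) ℂ) : Prop :=
  ∀ α : Fin n →₀ ℕ, ‖MvPowerSeries.coeff α g‖ * r ^ α.degree ≤ C

theorem CoeffBound.nonneg {n : ℕ} {r C : ℝ} {g : MvPowerSeries (Fin n) ℂ}
    (h : CoeffBound r C g) : 0 ≤ C := by
  have h0 := h 0
  simp only [map_zero, pow_zero, mul_one] at h0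
  exact (norm_nonneg _).trans h0

theorem CoeffBound.mono {n : ℕ} {r s C : ℝ} {g : MvPowerSeries (Fin n) ℂ}
    (h : CoeffBound r C g) (hs : 0 ≤ s) (hsr : s ≤ r) : CoeffBound s C g := fun α =>
  (mul_le_mul_of_nonneg_left (pow_le_pow_left₀ hs hsr _) (norm_nonneg _)).trans (h α)

theorem CoeffBound.add {n : ℕ} {r C D : ℝ} {g h : MvPowerSeries (Fin n) ℂ} (hr : 0 < r)
    (hg : CoeffBound r C g) (hh : CoeffBound r D h) : CoeffBound r (C + D) (g + h) := by
  intro α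
  rw [map_add]
  calc ‖MvPowerSeries.coeff α g + MvPowerSeries.coeff α h‖ * r ^ α.degree
      ≤ (‖MvPowerSeries.coeff α g‖ + ‖MvPowerSeries.coeff α h‖) * r ^ α.degree :=
        mul_le_mul_of_nonneg_right (norm_add_le _ _) (by positivity)
    _ ≤ C + D := by rw [add_mul]; exact add_le_add (hg α) (hh α)

theorem card_antidiagonal_le {n : ℕ} (α : Fin n →₀ ℕ) :
    (Finset.HasAntidiagonal.antidiagonal α).card ≤ 2 ^ α.degree := by
  classical
  have h1 : (Finset.HasAntidiagonal.antidiagonal α).card ≤ (Finset.Iic α).card := by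
    refine Finset.card_le_card_of_injOn Prod.fst ?_ ?_
    · intro p hp
      have hp' := Finset.HasAntidiagonal.mem_antidiagonal.1 (Finset.mem_coe.1 hp)
      rw [Finset.mem_coe, Finset.mem_Iic, ← hp']
      exact le_self_add
    · intro p hp q hq hpq
      have hp' := Finset.HasAntidiagonal.mem_antidiagonal.1 (Finset.mem_coe.1 hp)
      have hq' := Finset.HasAntidiagonal.mem_antidiagonal.1 (Finset.mem_coe.1 hq)
      refine Prod.ext hpq ?_
      have : p.1 + p.2 = p.1 + q.2 := by rw [hp', hpq, hq']
      exact add_left_cancel this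
  refine h1.trans ?_
  rw [Finsupp.card_Iic, Finsupp.degree_apply, ← Finset.prod_pow_eq_pow_sum]
  refine Finset.prod_le_prod' fun i _ => ?_
  rw [Nat.card_Iic]
  exact Nat.lt_two_pow_self

theorem CoeffBound.mul {n : ℕ} {r C D : ℝ} {g h : MvPowerSeries (Fin n) ℂ} (hr : 0 < r)
    (hg : CoeffBound r C g) (hh : CoeffBound r D h) : CoeffBound (r / 2) (C * D) (g * h) := by
  classical
  intro α
  rw [MvPowerSeries.coeff_mul]
  have hC := hg.nonneg
  have hD := hh.nonneg
  have key : ‖∑ p ∈ Finset.HasAntidiagonal.antidiagonal α, MvPowerSeries.coeff p.1 g * MvPowerSeries.coeff p.2 h‖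
      * r ^ α.degree ≤ 2 ^ α.degree * (C * D) := by
    calc _ ≤ (∑ p ∈ Finset.HasAntidiagonal.antidiagonal α,
            ‖MvPowerSeries.coeff p.1 g * MvPowerSeries.coeff p.2 h‖) * r ^ α.degree :=
          mul_le_mul_of_nonneg_right (norm_sum_le _ _) (by positivity)
      _ = ∑ p ∈ Finset.HasAntidiagonal.antidiagonal α,
            ‖MvPowerSeries.coeff p.1 g * MvPowerSeries.coeff p.2 h‖ * r ^ α.degree := by
          rw [Finset.sum_mul]
      _ ≤ ∑ p ∈ Finset.HasAntidiagonal.antidiagonal α, C * D := by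
          refine Finset.sum_le_sum fun p hp => ?_
          rw [← Finset.HasAntidiagonal.mem_antidiagonal.1 hp, map_add, pow_add, norm_mul, mul_mul_mul_comm]
          exact mul_le_mul (hg _) (hh _) (by positivity) hC
      _ = ((Finset.HasAntidiagonal.antidiagonal α).card : ℝ) * (C * D) := by
          rw [Finset.sum_const, nsmul_eq_mul]
      _ ≤ 2 ^ α.degree * (C * D) := by
          refine mul_le_mul_of_nonneg_right ?_ (mul_nonneg hC hD)
          exact_mod_cast card_antidiagonal_le α
  rw [div_pow, ← mul_div_assoc, div_le_iff₀ (by positivity), mul_comm (C * D)]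
  exact key

theorem coeffBound_C {n : ℕ} (r : ℝ) (c : ℂ) :
    CoeffBound r ‖c‖ (MvPowerSeries.C (σ := Fin n) c) := by
  classical
  intro α
  rw [MvPowerSeries.coeff_C]
  split_ifs with h
  · simp [h]
  · simp

theorem coeffBound_X {n : ℕ} (i : Fin n) :
    CoeffBound 1 1 (MvPowerSeries.X i : MvPowerSeries (Fin n) ℂ) := by
  classical
  intro α
  rw [MvPowerSeries.coeff_X]
  split_ifs <;> simp

/-- The ring `ℂ{x₁, …, xₙ}` of power series that converge in some neighbourhood of `0`. -/
def ConvSeries (n : ℕ) : Subalgebra ℂ (MvPowerSeries (Fin n) ℂ) where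
  carrier := {g | ∃ r > 0, ∃ C : ℝ, CoeffBound r C g}
  mul_mem' := by
    rintro g h ⟨r, hr, C, hg⟩ ⟨s, hs, D, hh⟩
    exact ⟨min r s / 2, by positivity, C * D,
      CoeffBound.mul (by positivity) (hg.mono (by positivity) (min_le_left _ _))
        (hh.mono (by positivity) (min_le_right _ _))⟩
  add_mem' := by
    rintro g h ⟨r, hr, C, hg⟩ ⟨s, hs, D, hh⟩
    exact ⟨min r s, by positivity, C + D,
      CoeffBound.add (by positivity) (hg.mono (by positivity) (min_le_left _ _))
        (hh.mono (by positivity) (min_le_right _ _))⟩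
  algebraMap_mem' := fun c => ⟨1, one_pos, ‖c‖, coeffBound_C 1 c⟩

/-- The coordinate ring `A₋ = ℂ[t₁, …, t_k]` of the base `T₋ = ℂᵏ`. -/
abbrev Base (k : ℕ) : Type := MvPolynomial (Fin k) ℂ

theorem exists_eval_bound {k : ℕ} (p : Base k) (R : ℝ) :
    ∃ C : ℝ, ∀ t : Fin k → ℂ, (∀ j, ‖t j‖ ≤ R) → ‖MvPolynomial.eval t p‖ ≤ C := by
  have hK : IsCompact (Set.pi Set.univ fun _ : Fin k => Metric.closedBall (0 : ℂ) R) :=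
    isCompact_univ_pi fun _ => isCompact_closedBall 0 R
  obtain ⟨C, hC⟩ := hK.exists_bound_of_continuousOn
    (f := fun t => MvPolynomial.eval t p) (MvPolynomial.continuous_eval p).continuousOn
  exact ⟨C, fun t ht => hC t fun j _ => by simpa using ht j⟩

/-- The ring `A₋{x}`: power series `∑ a_α(t) x^α` with polynomial coefficients `a_α ∈ A₋` that
converge in a neighbourhood of `{0} × T₋` in `ℂⁿ × T₋`, i.e. on every bounded polydisc in `t`
they satisfy a uniform bound `|a_α(t)| ≤ C r^{-|α|}` with some `r > 0`. -/
def relSubalgebra (n k : ℕ) : Subalgebra (Base k) (MvPowerSeries (Fin n) (Base k)) where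
  carrier := {g | ∀ R : ℝ, ∃ r > 0, ∃ C : ℝ, ∀ t : Fin k → ℂ, (∀ j, ‖t j‖ ≤ R) →
    CoeffBound r C (MvPowerSeries.map (MvPolynomial.eval t) g)}
  mul_mem' := by
    intro g h hg hh R
    obtain ⟨r, hr, C, hg⟩ := hg R
    obtain ⟨s, hs, D, hh⟩ := hh R
    refine ⟨min r s / 2, by positivity, C * D, fun t ht => ?_⟩
    rw [map_mul]
    exact CoeffBound.mul (by positivity) ((hg t ht).mono (by positivity) (min_le_left _ _))
        ((hh t ht).mono (by positivity) (min_le_right _ _))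
  add_mem' := by
    intro g h hg hh R
    obtain ⟨r, hr, C, hg⟩ := hg R
    obtain ⟨s, hs, D, hh⟩ := hh R
    refine ⟨min r s, by positivity, C + D, fun t ht => ?_⟩
    rw [map_add]
    exact CoeffBound.add (by positivity) ((hg t ht).mono (by positivity) (min_le_left _ _))
        ((hh t ht).mono (by positivity) (min_le_right _ _))
  algebraMap_mem' := by
    intro p R
    obtain ⟨C, hC⟩ := exists_eval_bound p R
    refine ⟨1, one_pos, C, fun t ht α => ?_⟩
    have h1 : MvPowerSeries.map (MvPolynomial.eval t)
        (algebraMap (Base k) (MvPowerSeries (Fin n) (Base k)) p)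
        = MvPowerSeries.C (MvPolynomial.eval t p) := by
      rw [← MvPowerSeries.c_eq_algebraMap, MvPowerSeries.map_C]
    rw [h1]
    exact (coeffBound_C 1 _ α).trans (hC t ht)

/-- `A₋{x}` as a type. -/
def RelSeries (n k : ℕ) : Type := relSubalgebra n k

instance (n k : ℕ) : CommRing (RelSeries n k) := inferInstanceAs (CommRing (relSubalgebra n k))

instance (n k : ℕ) : Algebra (Base k) (RelSeries n k) :=
  inferInstanceAs (Algebra (Base k) (relSubalgebra n k))

/-- The inclusion `A₋{x} → A₋[[x]]`. -/
def toSeries (n k : ℕ) : RelSeries n k →ₐ[Base k] MvPowerSeries (Fin n) (Base k) :=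
  (relSubalgebra n k).val

/-- The inclusion `ℂ[x] → ℂ{x}`. -/
def polyToConv (n : ℕ) : MvPolynomial (Fin n) ℂ →ₐ[ℂ] ConvSeries n :=
  MvPolynomial.aeval fun i => ⟨MvPowerSeries.X i, 1, one_pos, 1, coeffBound_X i⟩

theorem coe_polyToConv {n : ℕ} (p : MvPolynomial (Fin n) ℂ) :
    (polyToConv n p : MvPowerSeries (Fin n) ℂ) = (p : MvPowerSeries (Fin n) ℂ) := by
  have h : (ConvSeries n).val.comp (polyToConv n) =
      MvPolynomial.coeToMvPowerSeries.algHom ℂ := by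
    ext i : 1
    simp [polyToConv]
  simpa using DFunLike.congr_fun h p

theorem X_mem_relSubalgebra {n k : ℕ} (i : Fin n) :
    (MvPowerSeries.X i : MvPowerSeries (Fin n) (Base k)) ∈ relSubalgebra n k :=
  fun _ => ⟨1, one_pos, 1, fun t _ => by rw [MvPowerSeries.map_X]; exact coeffBound_X i⟩

/-- The variable `x_i` as an element of `A₋{x}`. -/
def relVar (n k : ℕ) (i : Fin n) : RelSeries n k :=
  (⟨MvPowerSeries.X i, X_mem_relSubalgebra i⟩ : relSubalgebra n k)

/-- The inclusion `A₋[x] → A₋{x}`. -/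
def polyToRel (n k : ℕ) : MvPolynomial (Fin n) (Base k) →ₐ[Base k] RelSeries n k :=
  MvPolynomial.aeval (relVar n k)

theorem coe_polyToRel {n k : ℕ} (p : MvPolynomial (Fin n) (Base k)) :
    toSeries n k (polyToRel n k p) =
      (p : MvPowerSeries (Fin n) (Base k)) := by
  have h : (toSeries n k).comp (polyToRel n k) =
      MvPolynomial.coeToMvPowerSeries.algHom (Base k) := by
    ext i : 1
    rw [AlgHom.comp_apply, polyToRel, MvPolynomial.aeval_X]
    rw [show toSeries n k (relVar n k i) = MvPowerSeries.X i from rfl]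
    simp
  simpa using DFunLike.congr_fun h p

/-! ### Isolated singularities, the Milnor algebra, upper monomials -/

/-- The hypersurface `f = 0` is singular at `0`, and at no other point of a neighbourhood. -/
def HasIsolatedSingularity {n : ℕ} (f : MvPolynomial (Fin n) ℂ) : Prop :=
  (MvPolynomial.eval 0 f = 0 ∧ ∀ i, MvPolynomial.eval 0 (MvPolynomial.pderiv i f) = 0) ∧
  ∀ᶠ x in 𝓝[≠] (0 : Fin n → ℂ),
    ¬ (MvPolynomial.eval x f = 0 ∧ ∀ i, MvPolynomial.eval x (MvPolynomial.pderiv i f) = 0)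

/-- The Milnor algebra `ℂ{x} / (∂f/∂x₁, …, ∂f/∂xₙ)`. -/
abbrev MilnorAlgebra {n : ℕ} (f : MvPolynomial (Fin n) ℂ) : Type :=
  ConvSeries n ⧸ Ideal.span (Set.range fun i => polyToConv n (MvPolynomial.pderiv i f))

/-- The class of the monomial `x^α` in the Milnor algebra. -/
def milnorMonomial {n : ℕ} (f : MvPolynomial (Fin n) ℂ) (α : Fin n →₀ ℕ) : MilnorAlgebra f :=
  Ideal.Quotient.mk _ (polyToConv n (MvPolynomial.monomial α 1))

/-- The monomials `x^α`, `α ∈ B`, form a `ℂ`-basis of the Milnor algebra of `f`. -/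
def IsMonomialBasis {n : ℕ} (f : MvPolynomial (Fin n) ℂ) (B : Set (Fin n →₀ ℕ)) : Prop :=
  LinearIndependent ℂ (fun α : B => milnorMonomial f α) ∧
  Submodule.span ℂ (milnorMonomial f '' B) = ⊤

/-- `m₁, …, m_k` is an enumeration without repetition of (the exponents of) the upper monomials
`x^α`, `α ∈ B`, of weighted degree `> d`. -/
structure EnumeratesUpper {n k : ℕ} (w : Fin n → ℕ) (d : ℕ) (B : Set (Fin n →₀ ℕ))
    (m : Fin k → (Fin n →₀ ℕ)) : Prop where
  injective : Function.Injective m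
  range_eq : Set.range m = {α | α ∈ B ∧ d < Finsupp.weight w α}

theorem EnumeratesUpper.ne_zero {n k : ℕ} {w : Fin n → ℕ} {d : ℕ} {B : Set (Fin n →₀ ℕ)}
    {m : Fin k → (Fin n →₀ ℕ)} (h : EnumeratesUpper w d B m) (j : Fin k) : m j ≠ 0 := by
  intro h0
  have hj : m j ∈ {α | α ∈ B ∧ d < Finsupp.weight w α} := h.range_eq ▸ Set.mem_range_self j
  have := hj.2
  rw [h0, map_zero] at this
  exact Nat.not_lt_zero _ this

/-! ### The unfolding `F`, the relative Milnor algebra and the Kodaira–Spencer map -/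

section Family

variable {n k : ℕ} (f₀ : MvPolynomial (Fin n) ℂ) (m : Fin k → (Fin n →₀ ℕ))

/-- `F(x,t) = f₀(x) + ∑ t_j m_j(x)` as an element of `A₋[x]`. -/
def unfoldingPoly : MvPolynomial (Fin n) (Base k) :=
  MvPolynomial.map MvPolynomial.C f₀ +
    ∑ j, MvPolynomial.monomial (m j) (MvPolynomial.X j : Base k)

/-- `F` as an element of `A₋{x}`. -/
def unfolding : RelSeries n k := polyToRel n k (unfoldingPoly f₀ m)

/-- The monomial `m_j` as an element of `A₋{x}`. -/
def upperMonomial (j : Fin k) : RelSeries n k :=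
  polyToRel n k (MvPolynomial.monomial (m j) 1)

/-- The ideal `(∂F/∂x₁, …, ∂F/∂xₙ)` of `A₋{x}`. -/
def relJacobian : Ideal (RelSeries n k) :=
  Ideal.span (Set.range fun i => polyToRel n k (MvPolynomial.pderiv i (unfoldingPoly f₀ m)))

/-- The relative Milnor algebra `I = A₋{x} / (∂F/∂x₁, …, ∂F/∂xₙ)`. -/
abbrev RelMilnorAlgebra : Type := RelSeries n k ⧸ relJacobian f₀ m

/-- The ideal `(x) = (x₁, …, xₙ)` of `A₋{x}`. -/
def xIdeal (n k : ℕ) : Ideal (RelSeries n k) :=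
  Ideal.span (Set.range fun i => polyToRel n k (MvPolynomial.X i))

/-- The ideal `(F) + (x) (∂F/∂x₁, …, ∂F/∂xₙ)` of `A₋{x}`. -/
def ksIdeal : Ideal (RelSeries n k) :=
  Ideal.span {unfolding f₀ m} ⊔ xIdeal n k * relJacobian f₀ m

/-- The `A₋`-module `(x)A₋{x} / ((F) + (x) (∂F/∂x₁, …, ∂F/∂xₙ))`. -/
abbrev KSTarget : Type :=
  ↥(xIdeal n k) ⧸ Submodule.comap (xIdeal n k).subtype (ksIdeal f₀ m)

/-- `δF = ∑ δ(t_j) m_j` for a vector field `δ ∈ Der_ℂ A₋`. -/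
def derivUnfolding : Derivation ℂ (Base k) (Base k) →ₗ[Base k] RelSeries n k where
  toFun δ := ∑ j, δ (MvPolynomial.X j) • upperMonomial m j
  map_add' := by
    intro δ δ'
    simp only [Derivation.add_apply, add_smul, Finset.sum_add_distrib]
  map_smul' := by
    intro a δ
    simp only [Derivation.smul_apply, smul_eq_mul, mul_smul, Finset.smul_sum, RingHom.id_apply]

/-- `derivUnfolding m δ` is obtained by applying `δ` to the coefficients of `F`. -/
theorem coeff_derivUnfolding (δ : Derivation ℂ (Base k) (Base k)) (α : Fin n →₀ ℕ) :
    MvPowerSeries.coeff α (toSeries n k (derivUnfolding m δ)) =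
      δ (MvPowerSeries.coeff α (toSeries n k (unfolding f₀ m))) := by
  classical
  have h1 : (toSeries n k (derivUnfolding m δ)) =
      ((∑ j, δ (MvPolynomial.X j) • MvPolynomial.monomial (m j) (1 : Base k) :
        MvPolynomial (Fin n) (Base k)) : MvPowerSeries (Fin n) (Base k)) := by
    rw [← coe_polyToRel, map_sum]
    simp only [map_smul]
    rfl
  rw [h1, unfolding, coe_polyToRel, MvPolynomial.coeff_coe, MvPolynomial.coeff_coe, unfoldingPoly,
    MvPolynomial.coeff_add, MvPolynomial.coeff_map, map_add, MvPolynomial.coeff_sum,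
    MvPolynomial.coeff_sum, map_sum]
  have h2 : δ (MvPolynomial.C (MvPolynomial.coeff α f₀)) = 0 := by
    rw [← MvPolynomial.algebraMap_eq]
    exact δ.map_algebraMap _
  rw [h2, zero_add]
  refine Finset.sum_congr rfl fun j _ => ?_
  rw [MvPolynomial.coeff_smul, MvPolynomial.coeff_monomial, MvPolynomial.coeff_monomial]
  split_ifs <;> simp

theorem upperMonomial_mem (j : Fin k) (hj : m j ≠ 0) : upperMonomial m j ∈ xIdeal n k := by
  classical
  obtain ⟨i, hi⟩ := Finsupp.ne_iff.1 hj
  have h1 : MvPolynomial.monomial (m j) (1 : Base k) =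
      MvPolynomial.monomial (m j - Finsupp.single i 1) 1 * MvPolynomial.X i := by
    rw [MvPolynomial.X, MvPolynomial.monomial_mul, mul_one, tsub_add_cancel_of_le]
    rw [Finsupp.single_le_iff]
    exact Nat.one_le_iff_ne_zero.2 hi
  rw [upperMonomial, h1, map_mul]
  exact Ideal.mul_mem_left _ _ (Ideal.subset_span ⟨i, rfl⟩)

theorem derivUnfolding_mem (hm : ∀ j, m j ≠ 0) (δ : Derivation ℂ (Base k) (Base k)) :
    derivUnfolding m δ ∈ (xIdeal n k).restrictScalars (Base k) := by
  change ∑ j, δ (MvPolynomial.X j) • upperMonomial m j ∈ _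
  exact Submodule.sum_mem ((xIdeal n k).restrictScalars (Base k)) fun j _ =>
    Submodule.smul_mem ((xIdeal n k).restrictScalars (Base k)) _ (upperMonomial_mem m j (hm j))

/-- The Kodaira–Spencer map
`ρ : Der_ℂ A₋ → (x)A₋{x} / ((F) + (x) (∂F/∂x₁, …, ∂F/∂xₙ))`, `ρ(δ) = class(δF)`. -/
def kodairaSpencer (hm : ∀ j, m j ≠ 0) :
    Derivation ℂ (Base k) (Base k) →ₗ[Base k] KSTarget f₀ m :=
  ((Submodule.mkQ (Submodule.comap (xIdeal n k).subtype (ksIdeal f₀ m))).restrictScalars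
    (Base k)).comp
    (LinearMap.codRestrict ((xIdeal n k).restrictScalars (Base k)) (derivUnfolding m)
      (derivUnfolding_mem m hm))

/-- The equations `n_i F = ∑_j h_{ij} m_j` in `I`, for all `i`. -/
def IsCoeffMatrix (N : Fin k → RelSeries n k) (h : Fin k → Fin k → Base k) : Prop :=
  ∀ i, (Ideal.Quotient.mk (relJacobian f₀ m) (N i * unfolding f₀ m) : RelMilnorAlgebra f₀ m) =
    ∑ j, h i j • Ideal.Quotient.mk (relJacobian f₀ m) (upperMonomial m j)

end Family

/-! ### Gradings -/

/-- The weight `w(t_j) = d - deg m_j` of `t_j`. -/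
def tWeight {n k : ℕ} (w : Fin n → ℕ) (d : ℕ) (m : Fin k → (Fin n →₀ ℕ)) (j : Fin k) : ℤ :=
  (d : ℤ) - (Finsupp.weight w (m j) : ℤ)

/-- `g = ∑ a_α(t) x^α ∈ A₋{x}` is homogeneous of degree `e` in `x` and `t`: the coefficient
`a_α` is homogeneous of degree `e - |α|`. -/
def IsHomogeneousSeries {n k : ℕ} (w : Fin n → ℕ) (v : Fin k → ℤ) (g : RelSeries n k)
    (e : ℤ) : Prop :=
  ∀ α : Fin n →₀ ℕ, MvPolynomial.IsWeightedHomogeneous v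
    (MvPowerSeries.coeff α (toSeries n k g))
    (e - (Finsupp.weight w α : ℤ))

/-- The vector field `δ` is homogeneous of degree `e`: it raises degrees by `e`. -/
def IsHomogeneousField {k : ℕ} (v : Fin k → ℤ) (δ : Derivation ℂ (Base k) (Base k))
    (e : ℤ) : Prop :=
  ∀ (p : Base k) (a : ℤ), MvPolynomial.IsWeightedHomogeneous v p a →
    MvPolynomial.IsWeightedHomogeneous v (δ p) (a + e)

/-- The vector field `∑ h_j ∂/∂t_j`. -/
def vectorField {k : ℕ} (h : Fin k → Base k) : Derivation ℂ (Base k) (Base k) :=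
  ∑ j, h j • MvPolynomial.pderiv j

end SemiQH

end

open SemiQH

open scoped Topology

noncomputable section

namespace SemiQH

/-! ### Regular sequences and transition determinants -/

section RegularSequence

universe u

/-! The proof makes the relative Milnor algebra $I$ a graded Frobenius algebra over $A_-$ and takes
for $n_i$ elements of a dual basis. Write $J_F$ for the ideal of the partial derivatives of $F$.

Freeness. The basis monomials $x^\alpha$, $\alpha\in B$, generate $I$: dividing by the derivatives
of $f_0$ instead of those of $F$ leaves an error of strictly larger weight, and by Nakayama's lemma
all monomials of large weight lie in $(x)J_F$ (`FamilyData.weightIdeal_le`,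
`FamilyData.hasNormalForm_monomial`). They are independent because of the residue pairing.

Pairing. If $x_i^{M}=\sum_j A_{ij}\,\partial_jf_0$, the functional $p\mapsto$ coefficient of
$x^{(M-1,\dots,M-1)}$ in $\det(A)\,p$ kills the Jacobian ideal by Cramer's rule. It is nondegenerate
on the Milnor algebra because $(x_1^M,\dots,x_n^M):\det A$ is contained in the Jacobian ideal
(`mem_span_of_det_mul_mem`). It is extended to a homogeneous functional $\psi$ on $I$. The Gram
determinant is then homogeneous and non-zero at $t=0$; as all $t_j$ have negative weight, it is a
non-zero constant (`FamilyData.exists_pairing`). Hence there is a homogeneous dual basis $N_\beta$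
(`FamilyData.exists_dualData`).

Conclusion. Let $n_i$ be the element dual to $m_{k-i+1}$. The coefficient of $m_j$ in $n_iF$ is
$\psi(n_iFN_{m_j})$, so the symmetry is commutativity of multiplication. By Euler's identity $F$ is
congruent to a polynomial with all monomials of weight $>d$, so multiples of $F$ involve upper
monomials only, and by symmetry $N_\beta F=0$ for the other $\beta$. If $\delta F\equiv gF$,
expanding $g$ in the dual basis therefore shows $\delta\in\sum A_-\delta_i$. Conversely, $F$ has
only monomials of weight $\ge d$, so its division by the $\partial_iF$ has coefficients in $(x)$;
thus $\delta_iF\equiv n_iF$ even modulo $(x)J_F$, as the Kodaira–Spencer map requires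
(`DualData.ker_kodairaSpencer`). -/

/-- The sequence `a` is weakly regular: each `a i` is a nonzerodivisor modulo the previous ones. -/
def IsRegSeq {R : Type u} [CommRing R] {n : ℕ} (a : Fin n → R) : Prop :=
  ∀ i g, a i * g ∈ Ideal.span (a '' Set.Iio i) → g ∈ Ideal.span (a '' Set.Iio i)

theorem image_castSucc_Iio {R : Type u} {n : ℕ} (a : Fin (n + 1) → R) (i : Fin n) :
    (a ∘ Fin.castSucc) '' Set.Iio i = a '' Set.Iio i.castSucc := by
  ext x
  simp only [Set.mem_image, Set.mem_Iio, Function.comp_apply]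
  constructor
  · rintro ⟨j, hj, rfl⟩
    exact ⟨j.castSucc, Fin.castSucc_lt_castSucc_iff.2 hj, rfl⟩
  · rintro ⟨j, hj, rfl⟩
    have hj' : j ≠ Fin.last n := fun h => by
      rw [h] at hj
      exact absurd hj (not_lt.2 (Fin.le_last _))
    refine ⟨j.castPred hj', ?_, by simp⟩
    rw [← Fin.castSucc_lt_castSucc_iff]
    simpa using hj

theorem span_image_Iio_succ {R : Type u} [CommRing R] {n : ℕ} (a : Fin (n + 1) → R) (i : Fin n) :
    Ideal.span (a '' Set.Iio i.succ) =
      Ideal.span {a i.castSucc} ⊔ Ideal.span (a '' Set.Iio i.castSucc) := by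
  rw [← Ideal.span_union, Set.singleton_union, ← Set.image_insert_eq]
  congr 2
  ext j
  simp only [Set.mem_Iio, Set.mem_insert_iff, Fin.lt_def, Fin.ext_iff, Fin.val_succ,
    Fin.val_castSucc]
  omega

/-- If $a_ig\equiv yh$ modulo the earlier terms, then $yh$ lies in the next initial ideal, hence so
does $h$; writing $h\equiv h'a_i$ and cancelling $a_i$ puts $g-yh'$ in the earlier ideal. The last
entry is dropped because `y` is not assumed to be a nonzerodivisor modulo all of `a`. -/
theorem IsRegSeq.quotient {R : Type u} [CommRing R] {n : ℕ} {a : Fin (n + 1) → R}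
    (ha : IsRegSeq a) (y : R)
    (hy : ∀ i g, y * g ∈ Ideal.span (a '' Set.Iio i) → g ∈ Ideal.span (a '' Set.Iio i)) :
    IsRegSeq fun i : Fin n => Ideal.Quotient.mk (Ideal.span {y}) (a i.castSucc) := by
  intro i g hg
  obtain ⟨g, rfl⟩ := Ideal.Quotient.mk_surjective g
  have himg : (fun i : Fin n => Ideal.Quotient.mk (Ideal.span {y}) (a i.castSucc)) '' Set.Iio i =
      Ideal.Quotient.mk (Ideal.span {y}) '' (a '' Set.Iio i.castSucc) := by
    rw [← image_castSucc_Iio, ← Set.image_comp]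
    rfl
  rw [himg, ← Ideal.map_span, ← map_mul, Ideal.mem_quotient_iff_mem_sup] at hg
  rw [himg, ← Ideal.map_span, Ideal.mem_quotient_iff_mem_sup]
  obtain ⟨p, hp, q, hq, hpq⟩ := Submodule.mem_sup.1 hg
  obtain ⟨h, rfl⟩ := Ideal.mem_span_singleton'.1 hq
  have h1 : y * h ∈ Ideal.span (a '' Set.Iio i.succ) := by
    rw [span_image_Iio_succ]
    have : y * h = a i.castSucc * g - p := by rw [← hpq]; ring
    rw [this]
    exact Ideal.sub_mem _ (Ideal.mem_sup_left (Ideal.mul_mem_right _ _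
      (Ideal.mem_span_singleton_self _))) (Ideal.mem_sup_right hp)
  have h2 := hy _ _ h1
  rw [span_image_Iio_succ] at h2
  obtain ⟨p', hp', q', hq', hpq'⟩ := Submodule.mem_sup.1 h2
  obtain ⟨h', rfl⟩ := Ideal.mem_span_singleton'.1 hp'
  have h3 : g - y * h' ∈ Ideal.span (a '' Set.Iio i.castSucc) := by
    apply ha
    have : a i.castSucc * (g - y * h') = p + y * q' := by
      have : a i.castSucc * g = p + (h' * a i.castSucc + q') * y := by rw [hpq']; exact hpq.symm
      rw [mul_sub, this]; ring
    rw [this]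
    exact Ideal.add_mem _ hp (Ideal.mul_mem_left _ _ hq')
  have : g = (g - y * h') + h' * y := by ring
  rw [this]
  exact Ideal.add_mem _ (Ideal.mem_sup_left h3)
    (Ideal.mem_sup_right (Ideal.mul_mem_left _ _ (Ideal.mem_span_singleton_self _)))

theorem range_eq_insert_image_Iio {R : Type u} {n : ℕ} (a : Fin (n + 1) → R) :
    Set.range a = insert (a (Fin.last n)) (a '' Set.Iio (Fin.last n)) := by
  rw [← Set.image_insert_eq, ← Set.image_univ]
  congr 1
  ext j
  simp only [Set.mem_univ, Set.mem_insert_iff, Set.mem_Iio, true_iff]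
  exact (Fin.le_last j).eq_or_lt

/-- Reduction of the statement on transition determinants to a sequence which is shorter by one,
if `b 0` is a nonzerodivisor modulo all initial segments of `a`. -/
theorem mem_span_of_det_mul_mem_of_quotient {R : Type u} [CommRing R] {n : ℕ}
    {a b : Fin (n + 1) → R} (A : Matrix (Fin (n + 1)) (Fin (n + 1)) R)
    (hab : A.mulVec b = a) (ha : IsRegSeq a)
    (hb : ∀ i g, b 0 * g ∈ Ideal.span (a '' Set.Iio i) → g ∈ Ideal.span (a '' Set.Iio i))
    (ih : ∀ (a' b' : Fin n → R ⧸ Ideal.span {b 0}) (A' : Matrix (Fin n) (Fin n) _),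
      A'.mulVec b' = a' → IsRegSeq a' →
      ∀ z, A'.det * z ∈ Ideal.span (Set.range a') → z ∈ Ideal.span (Set.range b'))
    {z : R} (hz : A.det * z ∈ Ideal.span (Set.range a)) : z ∈ Ideal.span (Set.range b) := by
  set I := Ideal.span (a '' Set.Iio (Fin.last n)) with hI
  set D := (A.submatrix Fin.castSucc Fin.succ).det with hD
  -- Only one cofactor matters below; its sign $(-1)^n$ enters through `ε * ε = 1` alone.
  obtain ⟨ε, hε, hadj⟩ : ∃ ε : R, ε * ε = 1 ∧ A.adjugate 0 (Fin.last n) = ε * D := by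
    refine ⟨(-1) ^ n, by rw [← pow_add, ← two_mul, pow_mul]; simp, ?_⟩
    rw [Matrix.adjugate_fin_succ_eq_det_submatrix, hD]
    simp [Fin.succAbove_last, Fin.succAbove_zero]
  -- Cramer's rule for `b 0`: modulo `I` only the last term of the expansion survives.
  have h1 : A.det * b 0 - ε * D * a (Fin.last n) ∈ I := by
    have h : A.adjugate.mulVec a = A.det • b := by
      rw [← hab, Matrix.mulVec_mulVec, Matrix.adjugate_mul, Matrix.smul_mulVec, Matrix.one_mulVec]
    have h0 := congrFun h 0
    rw [Matrix.mulVec, dotProduct, Fin.sum_univ_castSucc, hadj] at h0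
    simp only [Pi.smul_apply, smul_eq_mul] at h0
    rw [← h0, add_sub_cancel_right]
    refine Ideal.sum_mem _ fun i _ => Ideal.mul_mem_left _ _ (Ideal.subset_span ⟨_, ?_, rfl⟩)
    exact Fin.castSucc_lt_last i
  rw [range_eq_insert_image_Iio, Ideal.mem_span_insert] at hz
  obtain ⟨c, p, hp, hcp⟩ := hz
  -- Multiplying $\det(A)z=c\,a_{last}+p$ by $b_0$ and comparing with `h1`, the factor $a_{last}$
  -- cancels modulo `I`.
  have h2 : ε * D * z - b 0 * c ∈ I := by
    apply ha
    have : a (Fin.last n) * (ε * D * z - b 0 * c) =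
        b 0 * p - (A.det * b 0 - ε * D * a (Fin.last n)) * z := by
      linear_combination (b 0) * hcp
    rw [this]
    exact Ideal.sub_mem _ (Ideal.mul_mem_left _ _ hp) (Ideal.mul_mem_right _ _ h1)
  have h3 : D * z ∈ I ⊔ Ideal.span {b 0} := by
    have : D * z = ε * (ε * D * z - b 0 * c) + (ε * c) * b 0 := by
      linear_combination (-(D * z)) * hε
    rw [this]
    exact Ideal.add_mem _ (Ideal.mem_sup_left (Ideal.mul_mem_left _ _ h2))
      (Ideal.mem_sup_right (Ideal.mul_mem_left _ _ (Ideal.mem_span_singleton_self _)))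
  set π := Ideal.Quotient.mk (Ideal.span {b 0}) with hπ
  have hb0 : π (b 0) = 0 := Ideal.Quotient.eq_zero_iff_mem.2 (Ideal.mem_span_singleton_self _)
  have h4 := ih (fun i => π (a i.castSucc)) (fun j => π (b j.succ))
    ((A.submatrix Fin.castSucc Fin.succ).map π) ?_ (ha.quotient _ hb) (π z) ?_
  · have : Set.range (fun j : Fin n => π (b j.succ)) = π '' Set.range (fun j : Fin n => b j.succ) := by
      rw [← Set.range_comp]; rfl
    rw [this, ← Ideal.map_span, Ideal.mem_quotient_iff_mem_sup] at h4
    refine (sup_le (Ideal.span_mono ?_) (Ideal.span_mono ?_) :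
      Ideal.span (Set.range fun j : Fin n => b j.succ) ⊔ Ideal.span {b 0} ≤ _) h4
    · rintro _ ⟨j, rfl⟩
      exact ⟨_, rfl⟩
    · rintro _ rfl
      exact ⟨_, rfl⟩
  · ext i
    simp only [Matrix.mulVec, dotProduct, Matrix.map_apply, Matrix.submatrix_apply, ← hab]
    rw [Fin.sum_univ_succ, map_add, map_mul, hb0, mul_zero, zero_add, map_sum]
    simp only [map_mul]
  · have : ((A.submatrix Fin.castSucc Fin.succ).map π).det = π D := by
      rw [hD, RingHom.map_det]; rfl
    rw [this, ← map_mul]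
    have himg : Set.range (fun i : Fin n => π (a i.castSucc)) =
        π '' (a '' Set.Iio (Fin.last n)) := by
      ext x
      simp only [Set.mem_range, Set.mem_image, Set.mem_Iio, exists_exists_and_eq_and]
      constructor
      · rintro ⟨i, rfl⟩
        exact ⟨_, Fin.castSucc_lt_last i, rfl⟩
      · rintro ⟨i, hi, rfl⟩
        exact ⟨i.castPred hi.ne, by simp⟩
    rw [himg, ← Ideal.map_span, Ideal.mem_quotient_iff_mem_sup]
    exact h3

-- McCoy's theorem over $R/I$: a polynomial is a nonzerodivisor as soon as no non-zero constant
-- kills all its coefficients. It makes the generic combination of the $b_j$ a nonzerodivisor even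
-- when no single $b_j$ is one.
open Polynomial in
theorem mem_map_C_of_generic_mul_mem {R : Type u} [CommRing R] {n : ℕ} (I : Ideal R) (b : Fin n → R)
    (hb : ∀ r, (∀ j, r * b j ∈ I) → r ∈ I) (g : R[X])
    (hg : (∑ j, C (b j) * X ^ (j : ℕ)) * g ∈ I.map (C : R →+* R[X])) :
    g ∈ I.map (C : R →+* R[X]) := by
  set π := Ideal.Quotient.mk I
  have hker : ∀ f : R[X], f ∈ I.map (C : R →+* R[X]) ↔ f.map π = 0 := by
    intro f
    rw [Ideal.mem_map_C_iff, Polynomial.ext_iff]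
    simp only [coeff_map, coeff_zero]
    exact forall_congr' fun m => (Ideal.Quotient.eq_zero_iff_mem).symm
  rw [hker] at hg ⊢
  rw [Polynomial.map_mul] at hg
  set Q := (∑ j, C (b j) * X ^ (j : ℕ) : R[X]) with hQ
  have hcoeff : ∀ j : Fin n, Q.coeff j = b j := by
    intro j
    rw [hQ, finsetSum_coeff, Finset.sum_eq_single j]
    · simp
    · intro i _ hij
      rw [coeff_C_mul_X_pow, if_neg]
      exact fun h => hij (Fin.ext h.symm)
    · simp
  have hnzd : Q.map π ∈ nonZeroDivisors (R ⧸ I)[X] := by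
    rw [Polynomial.mem_nonZeroDivisors_iff]
    intro r hr
    obtain ⟨r, rfl⟩ := Ideal.Quotient.mk_surjective r
    refine Ideal.Quotient.eq_zero_iff_mem.2 (hb r fun j => ?_)
    have := congrArg (fun f => Polynomial.coeff f j) hr
    simp only [coeff_smul, coeff_map, hcoeff, coeff_zero, smul_eq_mul, ← map_mul, π] at this
    exact Ideal.Quotient.eq_zero_iff_mem.1 this
  exact (mul_left_mem_nonZeroDivisors_eq_zero_iff hnzd).1 hg

open Polynomial in
/-- If `a = A b` for a weakly regular sequence `a` then `(a) : det A ⊆ (b)`. -/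
theorem mem_span_of_det_mul_mem {n : ℕ} : ∀ {R : Type u} [CommRing R] (a b : Fin n → R)
    (A : Matrix (Fin n) (Fin n) R), A.mulVec b = a → IsRegSeq a →
    ∀ z, A.det * z ∈ Ideal.span (Set.range a) → z ∈ Ideal.span (Set.range b) := by
  induction n with
  | zero =>
    intro R _ a b A _ _ z hz
    simpa using hz
  | succ n ih =>
    intro R _ a b A hab ha z hz
    have hmap : ∀ i, Ideal.span ((fun i => C (a i)) '' Set.Iio i) =
        (Ideal.span (a '' Set.Iio i)).map (C : R →+* R[X]) := by
      intro i
      rw [Ideal.map_span, ← Set.image_comp]; rfl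
    -- `b 0` may be a zero divisor modulo initial segments of `a`, so over `R[X]` it is replaced by
    -- the generic combination, in which it has coefficient $X^0=1$. The matrix `A'` undoes this by
    -- column operations, so its determinant is that of `A`.
    let b' : Fin (n + 1) → R[X] := Function.update (fun j => C (b j)) 0 (∑ j, C (b j) * X ^ (j : ℕ))
    let A' : Matrix (Fin (n + 1)) (Fin (n + 1)) R[X] := fun i j =>
      C (A i j) + (if j = 0 then 0 else - X ^ (j : ℕ)) * C (A i 0)
    have hb's : ∀ j : Fin n, b' j.succ = C (b j.succ) := fun j =>
      Function.update_of_ne (Fin.succ_ne_zero j) _ _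
    have hb'0 : b' 0 = ∑ j, C (b j) * X ^ (j : ℕ) := Function.update_self _ _ _
    have hdet : A'.det = C A.det := by
      rw [RingHom.map_det, ← Matrix.det_transpose, ← Matrix.det_transpose (RingHom.mapMatrix C A)]
      refine Matrix.det_eq_of_forall_row_eq_smul_add_const
        (fun j => if j = 0 then 0 else - X ^ (j : ℕ)) 0 (if_pos rfl) fun i j => rfl
    have key := mem_span_of_det_mul_mem_of_quotient (a := fun i => C (a i)) (b := b') A' ?_ ?_ ?_
      (fun a' b' A' => ih a' b' A') (z := C z) ?_
    · have hle : Ideal.span (Set.range b') ≤ (Ideal.span (Set.range b)).map (C : R →+* R[X]) := by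
        rw [Ideal.span_le]
        rintro _ ⟨j, rfl⟩
        have hj : ∀ j, C (b j) ∈ (Ideal.span (Set.range b)).map (C : R →+* R[X]) := fun j =>
          Ideal.mem_map_of_mem _ (Ideal.subset_span ⟨j, rfl⟩)
        refine Fin.cases ?_ (fun j => ?_) j
        · rw [hb'0]
          exact Ideal.sum_mem _ fun j _ => Ideal.mul_mem_right _ _ (hj j)
        · rw [hb's]
          exact hj _
      -- The constant coefficient brings the membership back to `R`.
      have := Ideal.mem_map_C_iff.1 (hle key) 0
      simpa using this
    · ext1 i
      rw [Matrix.mulVec, dotProduct, Fin.sum_univ_succ, hb'0, ← hab, Matrix.mulVec, dotProduct,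
        Fin.sum_univ_succ, Fin.sum_univ_succ]
      simp only [hb's, A', if_true, Fin.succ_ne_zero, if_false, zero_mul, add_zero, Fin.val_zero,
        pow_zero, mul_one, map_add, map_mul, map_sum, mul_add, Finset.mul_sum, add_assoc,
        add_right_inj, ← Finset.sum_add_distrib]
      refine Finset.sum_congr rfl fun j _ => ?_
      ring
    · intro i g hg
      rw [hmap, Ideal.mem_map_C_iff] at *
      intro m
      have := hg m
      rw [coeff_C_mul] at this
      exact ha _ _ this
    · intro i g hg
      rw [hmap] at *
      rw [hb'0] at hg
      -- Since `a i` is a combination of the `b j`, an `r` multiplying every `b j` into the initial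
      -- ideal also multiplies `a i` into it, and regularity applies.
      refine mem_map_C_of_generic_mul_mem _ b (fun r hr => ha i r ?_) g hg
      have hai : a i = ∑ j, A i j * b j := by rw [← hab]; rfl
      rw [hai, Finset.sum_mul]
      refine Ideal.sum_mem _ fun j _ => ?_
      rw [mul_assoc, mul_comm (b j)]
      exact Ideal.mul_mem_left _ _ (hr j)
    · have : Set.range (fun i => C (a i)) = (C : R →+* R[X]) '' Set.range a := by
        rw [← Set.range_comp]; rfl
      rw [hdet, ← map_mul, this, ← Ideal.map_span]
      exact Ideal.mem_map_of_mem _ hz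

open MvPolynomial in
/-- Powers of the variables form a weakly regular sequence. -/
theorem isRegSeq_X_pow {n : ℕ} {S : Type u} [CommRing S] (M : ℕ) :
    IsRegSeq fun i : Fin n => (X i ^ M : MvPolynomial (Fin n) S) := by
  classical
  intro i g hg
  have himg : (fun i : Fin n => (X i ^ M : MvPolynomial (Fin n) S)) '' Set.Iio i =
      (fun s => monomial s (1 : S)) '' ((fun j => Finsupp.single j M) '' Set.Iio i) := by
    rw [← Set.image_comp]
    refine Set.image_congr fun j _ => ?_
    rw [X_pow_eq_monomial]; rfl
  rw [himg, mem_ideal_span_monomial_image] at hg ⊢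
  intro α hα
  simp only [X_pow_eq_monomial] at hg
  obtain ⟨_, ⟨j, hj, rfl⟩, hle⟩ := hg (Finsupp.single i M + α) (by
    rw [mem_support_iff, coeff_monomial_mul, one_mul]
    exact mem_support_iff.1 hα)
  refine ⟨_, ⟨j, hj, rfl⟩, ?_⟩
  rw [Finsupp.single_le_iff] at *
  simpa [Finsupp.single_apply, (ne_of_lt (Set.mem_Iio.1 hj)).symm] using hle

end RegularSequence

/-! ### Units and the augmentation ideal of `A₋{x}` -/

section RelSeriesRing

variable {n k : ℕ}

/-- Enlarging the index set to a box bounds the sum by a product of `n` geometric series. The point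
is that the bound does not depend on `α`. -/
theorem sum_antidiagonal_pow_degree_le {q : ℝ} (hq0 : 0 ≤ q) (hq1 : q < 1) (α : Fin n →₀ ℕ) :
    ∑ p ∈ Finset.HasAntidiagonal.antidiagonal α, q ^ p.1.degree ≤ ((1 - q)⁻¹) ^ n := by
  classical
  set N := α.degree + 1
  calc ∑ p ∈ Finset.HasAntidiagonal.antidiagonal α, q ^ p.1.degree
      = ∑ f ∈ (Finset.HasAntidiagonal.antidiagonal α).image (fun p => (p.1 : Fin n → ℕ)),
          ∏ i, q ^ f i := by
        rw [Finset.sum_image]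
        · refine Finset.sum_congr rfl fun p _ => ?_
          rw [Finset.prod_pow_eq_pow_sum, Finsupp.degree_eq_sum]
        · intro p hp p' hp' h
          have h1 : p.1 = p'.1 := DFunLike.coe_injective h
          refine Prod.ext h1 (add_left_cancel (a := p.1) ?_)
          rw [Finset.HasAntidiagonal.mem_antidiagonal.1 hp, h1,
            Finset.HasAntidiagonal.mem_antidiagonal.1 hp']
    _ ≤ ∑ f ∈ Fintype.piFinset fun _ : Fin n => Finset.range N, ∏ i, q ^ f i := by
        refine Finset.sum_le_sum_of_subset_of_nonneg ?_ fun _ _ _ =>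
          Finset.prod_nonneg fun _ _ => pow_nonneg hq0 _
        intro f hf
        obtain ⟨p, hp, rfl⟩ := Finset.mem_image.1 hf
        rw [Fintype.mem_piFinset]
        intro i
        rw [Finset.mem_range, Nat.lt_succ_iff]
        refine (Finsupp.le_degree i p.1).trans ?_
        rw [← Finset.HasAntidiagonal.mem_antidiagonal.1 hp, map_add]
        exact Nat.le_add_right _ _
    _ = ∏ _i : Fin n, ∑ b ∈ Finset.range N, q ^ b := by rw [Finset.prod_univ_sum]
    _ ≤ ∏ _i : Fin n, (1 - q)⁻¹ := by
        refine Finset.prod_le_prod (fun _ _ => Finset.sum_nonneg fun _ _ => pow_nonneg hq0 _)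
          fun _ _ => ?_
        rw [← tsum_geometric_of_lt_one hq0 hq1]
        exact (summable_geometric_of_lt_one hq0 hq1).sum_le_tsum _ fun _ _ => pow_nonneg hq0 _
    _ = ((1 - q)⁻¹) ^ n := by simp

/-- The expression is continuous in `q` and vanishes at `q = 0`. The value `1` on the right is the
bound that reproduces itself in the recursion for the inverse series. -/
theorem exists_small_ratio (n : ℕ) (C : ℝ) :
    ∃ q : ℝ, 0 < q ∧ q < 1 ∧ C * (((1 - q)⁻¹) ^ n - 1) ≤ 1 := by
  have hc : ContinuousAt (fun q : ℝ => C * (((1 - q)⁻¹) ^ n - 1)) 0 := by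
    have : ContinuousAt (fun q : ℝ => (1 - q)⁻¹) 0 :=
      ContinuousAt.inv₀ (by fun_prop) (by norm_num)
    fun_prop
  have h1 : ∀ᶠ q in 𝓝 (0 : ℝ), C * (((1 - q)⁻¹) ^ n - 1) < 1 :=
    hc.eventually_lt continuousAt_const (by simp)
  have h2 : ∀ᶠ q in 𝓝 (0 : ℝ), q < 1 := eventually_lt_nhds one_pos
  have h3 := ((h1.and h2).filter_mono (nhdsWithin_le_nhds (s := Set.Ioi 0))).and
    self_mem_nhdsWithin
  obtain ⟨q, ⟨hq1, hq2⟩, hq3⟩ := h3.exists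
  exact ⟨q, hq3, hq2, hq1.le⟩

/-- Uniform coefficient bounds for the inverse of a power series with constant term `1`. -/
theorem exists_coeffBound_inverse (n : ℕ) {r : ℝ} (hr : 0 < r) (C : ℝ) :
    ∃ ρ > 0, ∀ u y : MvPowerSeries (Fin n) ℂ, CoeffBound r C u →
      MvPowerSeries.coeff 0 u = 1 → u * y = 1 → CoeffBound ρ 1 y := by
  classical
  obtain ⟨q, hq0, hq1, hq⟩ := exists_small_ratio n C
  -- Shrinking the radius by `q` gives each term $u_\beta y_{\alpha-\beta}$ of the recursion for
  -- $y_\alpha$ a factor $q^{|\beta|}$; summed over $\beta\ne0$ these preserve the bound `1`.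
  refine ⟨r * q, by positivity, fun u y hu hu0 huy => ?_⟩
  have hC := hu.nonneg
  intro α
  induction hN : α.degree using Nat.strong_induction_on generalizing α with
  | _ N ih =>
  subst hN
  have hα := congrArg (MvPowerSeries.coeff α) huy
  have h0 : ((0 : Fin n →₀ ℕ), α) ∈ Finset.HasAntidiagonal.antidiagonal α := by simp
  rw [MvPowerSeries.coeff_mul, ← Finset.add_sum_erase _ _ h0, hu0, one_mul] at hα
  rcases eq_or_ne α 0 with rfl | hne
  · have : (Finset.HasAntidiagonal.antidiagonal (0 : Fin n →₀ ℕ)).erase (0, 0) = ∅ := by simp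
    rw [this, Finset.sum_empty, add_zero, MvPowerSeries.coeff_one, if_pos rfl] at hα
    simp [hα]
  rw [MvPowerSeries.coeff_one, if_neg hne] at hα
  rw [eq_neg_of_add_eq_zero_left hα, norm_neg]
  calc ‖∑ p ∈ (Finset.HasAntidiagonal.antidiagonal α).erase (0, α),
          MvPowerSeries.coeff p.1 u * MvPowerSeries.coeff p.2 y‖ * (r * q) ^ α.degree
      ≤ (∑ p ∈ (Finset.HasAntidiagonal.antidiagonal α).erase (0, α),
          ‖MvPowerSeries.coeff p.1 u * MvPowerSeries.coeff p.2 y‖) * (r * q) ^ α.degree :=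
        mul_le_mul_of_nonneg_right (norm_sum_le _ _) (by positivity)
    _ ≤ ∑ p ∈ (Finset.HasAntidiagonal.antidiagonal α).erase (0, α), C * q ^ p.1.degree := by
        rw [Finset.sum_mul]
        refine Finset.sum_le_sum fun p hp => ?_
        rw [Finset.mem_erase] at hp
        have hp' := Finset.HasAntidiagonal.mem_antidiagonal.1 hp.2
        have hp1 : p.1 ≠ 0 := fun h => hp.1 (Prod.ext h (by rw [← hp', h, zero_add]))
        have hdeg : α.degree = p.1.degree + p.2.degree := by rw [← hp', map_add]
        have hpos : 0 < p.1.degree :=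
          Nat.pos_of_ne_zero fun h => hp1 ((Finsupp.degree_eq_zero_iff _).1 h)
        have h2 := ih _ (by omega) p.2 rfl
        rw [hdeg, pow_add, norm_mul, mul_mul_mul_comm]
        calc _ ≤ ‖MvPowerSeries.coeff p.1 u‖ * (r * q) ^ p.1.degree * 1 :=
              mul_le_mul_of_nonneg_left h2 (by positivity)
          _ = (‖MvPowerSeries.coeff p.1 u‖ * r ^ p.1.degree) * q ^ p.1.degree := by
              rw [mul_pow]; ring
          _ ≤ _ := mul_le_mul_of_nonneg_right (hu _) (by positivity)
    _ = C * ((∑ p ∈ Finset.HasAntidiagonal.antidiagonal α, q ^ p.1.degree) - 1) := by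
        rw [← Finset.add_sum_erase _ _ h0, ← Finset.mul_sum]
        simp
    _ ≤ C * (((1 - q)⁻¹) ^ n - 1) :=
        mul_le_mul_of_nonneg_left
          (sub_le_sub_right (sum_antidiagonal_pow_degree_le hq0.le hq1 α) 1) hC
    _ ≤ 1 := hq

theorem toSeries_injective : Function.Injective (toSeries n k) := Subtype.val_injective

/-- A formal series with the required convergence property as an element of `A₋{x}`. -/
def ofSeries (g : MvPowerSeries (Fin n) (Base k)) (hg : g ∈ relSubalgebra n k) : RelSeries n k :=
  (⟨g, hg⟩ : relSubalgebra n k)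

theorem toSeries_ofSeries (g : MvPowerSeries (Fin n) (Base k)) (hg : g ∈ relSubalgebra n k) :
    toSeries n k (ofSeries g hg) = g := rfl

/-- A series in `A₋{x}` with constant term `1` is a unit. -/
theorem isUnit_of_coeff_zero_eq_one (g : RelSeries n k)
    (hg : MvPowerSeries.coeff 0 (toSeries n k g) = 1) : IsUnit g := by
  set y := MvPowerSeries.invOfUnit (toSeries n k g) 1
  have hy : toSeries n k g * y = 1 := MvPowerSeries.mul_invOfUnit _ _ (by simpa using hg)
  have hmem : y ∈ relSubalgebra n k := by
    intro R
    obtain ⟨r, hr, C, hC⟩ := g.2 R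
    -- `ρ` depends only on `r` and `C`, so it serves all `t` in the polydisc at once.
    obtain ⟨ρ, hρ, h⟩ := exists_coeffBound_inverse n hr C
    refine ⟨ρ, hρ, 1, fun t ht => h _ _ (hC t ht) ?_ ?_⟩
    · rw [MvPowerSeries.coeff_map]
      exact (congrArg _ hg).trans (map_one _)
    · rw [← map_mul]
      exact (congrArg _ hy).trans (map_one _)
  exact IsUnit.of_mul_eq_one (ofSeries y hmem) (toSeries_injective (by
    rw [map_mul, map_one, toSeries_ofSeries, hy]))

theorem coeff_zero_of_mem_xIdeal {g : RelSeries n k} (hg : g ∈ xIdeal n k) :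
    MvPowerSeries.coeff 0 (toSeries n k g) = 0 := by
  have hle : xIdeal n k ≤
      RingHom.ker ((MvPowerSeries.constantCoeff).comp (toSeries n k).toRingHom) := by
    rw [xIdeal, Ideal.span_le]
    rintro _ ⟨i, rfl⟩
    simp [RingHom.mem_ker, coe_polyToRel]
  simpa using hle hg

/-- The element $1+gy$ has constant term `1`, hence is a unit. This gives access to Nakayama's lemma
although $A_-\{x\}$ is not local for $k>0$. -/
theorem xIdeal_le_jacobson : xIdeal n k ≤ Ideal.jacobson ⊥ := by
  intro g hg
  rw [Ideal.mem_jacobson_bot]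
  intro y
  refine isUnit_of_coeff_zero_eq_one _ ?_
  rw [map_add, map_add, coeff_zero_of_mem_xIdeal (Ideal.mul_mem_right _ _ hg)]
  simp

/-- The `i`-th part of a series in the decomposition `g = g(0) + ∑ xᵢ gᵢ`, where `xᵢ gᵢ` collects the
monomials of `g` whose first variable is `xᵢ`. -/
def divVar {S : Type*} [CommRing S] (i : Fin n) (g : MvPowerSeries (Fin n) S) :
    MvPowerSeries (Fin n) S :=
  fun α => if ∀ j < i, α j = 0 then MvPowerSeries.coeff (α + Finsupp.single i 1) g else 0

theorem coeff_divVar {S : Type*} [CommRing S] (i : Fin n) (g : MvPowerSeries (Fin n) S)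
    (α : Fin n →₀ ℕ) : MvPowerSeries.coeff α (divVar i g) =
      if ∀ j < i, α j = 0 then MvPowerSeries.coeff (α + Finsupp.single i 1) g else 0 := rfl

theorem sum_X_mul_divVar {S : Type*} [CommRing S] (g : MvPowerSeries (Fin n) S)
    (hg : MvPowerSeries.coeff 0 g = 0) : ∑ i, MvPowerSeries.X i * divVar i g = g := by
  classical
  ext α
  rw [map_sum]
  simp only [MvPowerSeries.X_def, MvPowerSeries.coeff_monomial_mul, one_mul, coeff_divVar]
  rcases eq_or_ne α 0 with rfl | hα
  · rw [hg]
    refine Finset.sum_eq_zero fun i _ => if_neg fun h => ?_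
    have := h i
    simp at this
  obtain ⟨i₀, hi₀, hmin⟩ : ∃ i, α i ≠ 0 ∧ ∀ j < i, α j = 0 := by
    have hne : α.support.Nonempty := Finsupp.support_nonempty_iff.2 hα
    refine ⟨α.support.min' hne, Finsupp.mem_support_iff.1 (Finset.min'_mem _ _), fun j hj => ?_⟩
    by_contra h
    exact absurd (Finset.min'_le _ _ (Finsupp.mem_support_iff.2 h)) (not_le.2 hj)
  have hle : Finsupp.single i₀ 1 ≤ α := by
    rw [Finsupp.single_le_iff]; exact Nat.one_le_iff_ne_zero.2 hi₀
  rw [Finset.sum_eq_single i₀]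
  · rw [if_pos hle, if_pos, tsub_add_cancel_of_le hle]
    intro j hj
    simp [hmin j hj]
  · intro i _ hi
    split_ifs with h1 h2
    · exfalso
      rw [Finsupp.single_le_iff] at h1
      rcases lt_or_gt_of_ne hi with h | h
      · have := hmin i h
        omega
      · have := h2 i₀ h
        rw [Finsupp.tsub_apply, Finsupp.single_eq_of_ne (by exact hi.symm)] at this
        omega
    · rfl
    · rfl
  · simp

theorem divVar_mem_relSubalgebra (i : Fin n) {g : MvPowerSeries (Fin n) (Base k)}
    (hg : g ∈ relSubalgebra n k) : divVar i g ∈ relSubalgebra n k := by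
  intro R
  obtain ⟨r, hr, C, hC⟩ := hg R
  refine ⟨r, hr, C / r, fun t ht α => ?_⟩
  have hC0 := (hC t ht).nonneg
  rw [MvPowerSeries.coeff_map, coeff_divVar]
  split_ifs
  · have h := hC t ht (α + Finsupp.single i 1)
    rw [MvPowerSeries.coeff_map, map_add, Finsupp.degree_single, pow_succ, ← mul_assoc] at h
    rwa [le_div_iff₀ hr]
  · rw [map_zero, norm_zero, zero_mul]
    positivity

/-- Splitting off the first variable of each monomial only shifts coefficients, so the quotients
still converge. -/
theorem mem_xIdeal_of_coeff_zero {g : RelSeries n k}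
    (hg : MvPowerSeries.coeff 0 (toSeries n k g) = 0) : g ∈ xIdeal n k := by
  have h : g = ∑ i, relVar n k i *
      ofSeries (divVar i (toSeries n k g)) (divVar_mem_relSubalgebra i g.2) := by
    apply toSeries_injective
    rw [map_sum]
    simp only [map_mul]
    exact (sum_X_mul_divVar _ hg).symm
  rw [h]
  refine Ideal.sum_mem _ fun i _ => Ideal.mul_mem_right _ _ (Ideal.subset_span ⟨i, ?_⟩)
  simp [polyToRel]

/-- Modulo a power of `(x)`, every element of `A₋{x}` is a polynomial. -/
theorem exists_poly_sub_mem_xIdeal_pow (N : ℕ) (g : RelSeries n k) :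
    ∃ p : MvPolynomial (Fin n) (Base k), g - polyToRel n k p ∈ xIdeal n k ^ N := by
  induction N generalizing g with
  | zero => exact ⟨0, by simp⟩
  | succ N ih =>
    set c := MvPowerSeries.coeff 0 (toSeries n k g)
    have hc : g - polyToRel n k (MvPolynomial.C c) ∈ xIdeal n k := by
      apply mem_xIdeal_of_coeff_zero
      rw [map_sub, map_sub, coe_polyToRel]
      simp [c]
    suffices h : ∀ y ∈ xIdeal n k,
        ∃ p : MvPolynomial (Fin n) (Base k), y - polyToRel n k p ∈ xIdeal n k ^ (N + 1) by
      obtain ⟨p, hp⟩ := h _ hc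
      exact ⟨MvPolynomial.C c + p, by rwa [map_add, ← sub_sub]⟩
    intro y hy
    induction hy using Submodule.span_induction with
    | mem y hy =>
      obtain ⟨i, rfl⟩ := hy
      exact ⟨MvPolynomial.X i, by simp⟩
    | zero => exact ⟨0, by simp⟩
    | add y z _ _ hy hz =>
      obtain ⟨p, hp⟩ := hy
      obtain ⟨p', hp'⟩ := hz
      exact ⟨p + p', by rw [map_add, add_sub_add_comm]; exact Ideal.add_mem _ hp hp'⟩
    | smul a y hy' hy =>
      obtain ⟨p, hp⟩ := hy
      obtain ⟨p', hp'⟩ := ih a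
      refine ⟨p' * p, ?_⟩
      have : a • y - polyToRel n k (p' * p) =
          (a - polyToRel n k p') * y + polyToRel n k p' * (y - polyToRel n k p) := by
        rw [map_mul, smul_eq_mul]; ring
      rw [this]
      refine Ideal.add_mem _ ?_ (Ideal.mul_mem_left _ _ hp)
      rw [pow_succ]
      exact Ideal.mul_mem_mul hp' hy'

end RelSeriesRing

/-! ### The Milnor algebra of a quasihomogeneous polynomial -/

section Quasihomogeneous

open MvPolynomial

variable {n : ℕ}

/-- The weights, as integers. -/
def intWeight (w : Fin n → ℕ) (i : Fin n) : ℤ := w i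

theorem weight_intWeight (w : Fin n → ℕ) (α : Fin n →₀ ℕ) :
    Finsupp.weight (intWeight w) α = (Finsupp.weight w α : ℤ) := by
  rw [Finsupp.weight_eq_sum, Finsupp.weight_eq_sum]
  simp [intWeight]

theorem isWeightedHomogeneous_intWeight {S : Type*} [CommRing S] {w : Fin n → ℕ}
    {p : MvPolynomial (Fin n) S} {e : ℕ} (hp : IsWeightedHomogeneous w p e) :
    IsWeightedHomogeneous (intWeight w) p (e : ℤ) := fun α hα => by
  rw [weight_intWeight, hp hα]

theorem isWeightedHomogeneous_pderiv {S : Type*} [CommRing S] {w : Fin n → ℕ}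
    {p : MvPolynomial (Fin n) S} {e : ℕ} (hp : IsWeightedHomogeneous w p e) (i : Fin n) :
    IsWeightedHomogeneous (intWeight w) (pderiv i p) ((e : ℤ) - w i) :=
  (isWeightedHomogeneous_intWeight hp).pderiv (by simp [intWeight])

/-- The ideal of `ℂ[x]` generated by the partial derivatives. -/
def polyJacobian (f : MvPolynomial (Fin n) ℂ) : Ideal (MvPolynomial (Fin n) ℂ) :=
  Ideal.span (Set.range fun i => pderiv i f)

/-- The exponent is an integer because it will be $d-w_i$, which is not known to be non-negative. -/
theorem eval_zpow_mul {w : Fin n → ℕ} {p : MvPolynomial (Fin n) ℂ} {e : ℤ}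
    (hp : IsWeightedHomogeneous (intWeight w) p e) (c : ℂ) (x : Fin n → ℂ) :
    eval (fun i => c ^ w i * x i) p = c ^ e * eval x p := by
  rw [eval_eq', eval_eq', Finset.mul_sum]
  refine Finset.sum_congr rfl fun α hα => ?_
  have h := hp (mem_support_iff.1 hα)
  rw [← h, weight_intWeight, zpow_natCast, Finsupp.weight_eq_sum]
  simp only [mul_pow, Finset.prod_mul_distrib, ← pow_mul, Finset.prod_pow_eq_pow_sum, smul_eq_mul,
    mul_comm (w _)]
  ring

/-- A quasihomogeneous polynomial in at least one variable with an isolated singularity has positive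
degree. -/
theorem degree_ne_zero {w : Fin n → ℕ} (hw : ∀ i, 0 < w i) {d : ℕ} {f : MvPolynomial (Fin n) ℂ}
    (hf : IsWeightedHomogeneous w f d) (hsing : HasIsolatedSingularity f) (i₀ : Fin n) : d ≠ 0 := by
  rintro rfl
  have hf' : f = C (coeff 0 f) := by
    ext α
    rw [coeff_C]
    split_ifs with h
    · rw [← h]
    · by_contra hne
      have hα := hf hne
      apply h
      ext i
      have := Finsupp.le_weight w (hw i).ne' α
      rw [hα] at this
      simpa using (Nat.le_zero.1 this).symm
  have h0 : coeff 0 f = 0 := by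
    have := hsing.1.1
    rw [hf', eval_C] at this
    exact this
  rw [h0, C_0] at hf'
  have : Nontrivial (Fin n → ℂ) := by
    have : Nonempty (Fin n) := ⟨i₀⟩
    infer_instance
  have hbot : (𝓝[≠] (0 : Fin n → ℂ)).NeBot := Module.punctured_nhds_neBot ℂ (Fin n → ℂ) 0
  obtain ⟨x, hx⟩ := hsing.2.exists
  apply hx
  simp [hf']

/-- The origin is the only common zero of the partial derivatives. -/
theorem eq_zero_of_eval_pderiv {w : Fin n → ℕ} (hw : ∀ i, 0 < w i) {d : ℕ}
    {f : MvPolynomial (Fin n) ℂ} (hf : IsWeightedHomogeneous w f d)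
    (hsing : HasIsolatedSingularity f) {x : Fin n → ℂ} (hx : ∀ i, eval x (pderiv i f) = 0) :
    x = 0 := by
  by_contra hne
  obtain ⟨i₀, hi₀⟩ := Function.ne_iff.1 hne
  have hd := degree_ne_zero hw hf hsing i₀
  -- The orbit of `x` under the weighted torus action consists of common zeros of the derivatives
  -- and tends to the origin. Euler's identity, with `d ≠ 0`, places it on $f=0$, so the singularity
  -- would not be isolated.
  have htend : Filter.Tendsto (fun c : ℂ => fun i => c ^ w i * x i) (𝓝[≠] 0)
      (𝓝[≠] (0 : Fin n → ℂ)) := by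
    rw [tendsto_nhdsWithin_iff]
    constructor
    · refine Filter.Tendsto.mono_left ?_ nhdsWithin_le_nhds
      have hc : Continuous fun c : ℂ => fun i => c ^ w i * x i := by fun_prop
      have := hc.tendsto 0
      convert this using 2
      ext i
      simp [(hw i).ne']
    · filter_upwards [self_mem_nhdsWithin] with c hc
      intro h
      have := congrFun h i₀
      simp only [Pi.zero_apply, mul_eq_zero] at this
      rcases this with h | h
      · exact hc (pow_eq_zero_iff (hw i₀).ne' |>.1 h)
      · exact hi₀ h
  obtain ⟨c, hc⟩ := (htend.eventually hsing.2).exists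
  have hder : ∀ i, eval (fun i => c ^ w i * x i) (pderiv i f) = 0 := fun i => by
    rw [eval_zpow_mul (isWeightedHomogeneous_pderiv hf i), hx, mul_zero]
  refine hc ⟨?_, hder⟩
  have heuler := congrArg (eval fun i => c ^ w i * x i) hf.sum_weight_X_mul_pderiv
  rw [map_sum] at heuler
  simp only [nsmul_eq_mul, map_mul, hder, mul_zero, Finset.sum_const_zero, map_natCast] at heuler
  exact (mul_eq_zero.1 heuler.symm).resolve_left (Nat.cast_ne_zero.2 hd)

/-- Some power of every variable lies in the Jacobian ideal. -/
theorem exists_X_pow_mem_polyJacobian {w : Fin n → ℕ} (hw : ∀ i, 0 < w i) {d : ℕ}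
    {f : MvPolynomial (Fin n) ℂ} (hf : IsWeightedHomogeneous w f d)
    (hsing : HasIsolatedSingularity f) :
    ∃ M : ℕ, ∀ i, (X i ^ M : MvPolynomial (Fin n) ℂ) ∈ polyJacobian f := by
  have h : ∀ i, ∃ M : ℕ, (X i ^ M : MvPolynomial (Fin n) ℂ) ∈ polyJacobian f := by
    intro i
    change X i ∈ (polyJacobian f).radical
    -- Nullstellensatz: the zero locus is at most the origin, where `X i` vanishes.
    rw [← vanishingIdeal_zeroLocus_eq_radical (K := ℂ)]
    intro x hx
    have : x = 0 := eq_zero_of_eval_pderiv hw hf hsing fun j => by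
      have := hx (pderiv j f) (Ideal.subset_span ⟨j, rfl⟩)
      simpa [aeval_eq_eval] using this
    simp [this]
  choose M hM using h
  refine ⟨∑ i, M i, fun i => Ideal.pow_mem_of_pow_mem _ (hM i) ?_⟩
  exact Finset.single_le_sum (f := M) (fun _ _ => Nat.zero_le _) (Finset.mem_univ i)

/-- Positive weights leave only finitely many monomials of each weight, so a graded part of a power
series is a polynomial. -/
theorem exists_homogeneous_part {w : Fin n → ℕ} (hw : ∀ i, 0 < w i) (e : ℤ)
    (s : MvPowerSeries (Fin n) ℂ) :
    ∃ p : MvPolynomial (Fin n) ℂ, ∀ α, coeff α p =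
      if Finsupp.weight (intWeight w) α = e then MvPowerSeries.coeff α s else 0 := by
  classical
  have hfin : {α : Fin n →₀ ℕ | Finsupp.weight w α ≤ e.toNat}.Finite :=
    Finsupp.finite_of_nat_weight_le w (fun i => (hw i).ne') _
  refine ⟨∑ β ∈ hfin.toFinset, monomial β
    (if Finsupp.weight (intWeight w) β = e then MvPowerSeries.coeff β s else 0), fun α => ?_⟩
  rw [coeff_sum]
  simp only [coeff_monomial]
  rw [Finset.sum_ite_eq']
  split_ifs with h1 h2 h2
  · rfl
  · rfl
  · exfalso
    apply h1
    rw [weight_intWeight] at h2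
    rw [Set.Finite.mem_toFinset]
    change Finsupp.weight w α ≤ e.toNat
    omega
  · rfl

/-- The homogeneous components of a combination of the partial derivatives of `f` are combinations
with homogeneous coefficients. -/
theorem exists_homogeneous_combination {w : Fin n → ℕ} (hw : ∀ i, 0 < w i) {d : ℕ}
    {f : MvPolynomial (Fin n) ℂ} (hf : IsWeightedHomogeneous w f d) (e : ℤ)
    (p : MvPolynomial (Fin n) ℂ) (S : Fin n → MvPowerSeries (Fin n) ℂ)
    (hp : (p : MvPowerSeries (Fin n) ℂ) = ∑ i, S i * (pderiv i f : MvPolynomial (Fin n) ℂ)) :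
    ∃ s : Fin n → MvPolynomial (Fin n) ℂ,
      (∀ i, IsWeightedHomogeneous (intWeight w) (s i) (e - (d - w i))) ∧
      weightedHomogeneousComponent (intWeight w) e p = ∑ i, s i * pderiv i f := by
  classical
  -- Each `S i` is cut down to the degree complementary to that of the `i`-th derivative. This is
  -- how membership over convergent series descends to polynomials.
  choose s hs using fun i => exists_homogeneous_part hw (e - (d - w i)) (S i)
  have hsh : ∀ i, IsWeightedHomogeneous (intWeight w) (s i) (e - (d - w i)) := by
    intro i α hα
    rw [hs] at hα
    by_contra h
    exact hα (if_neg h)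
  refine ⟨s, hsh, ?_⟩
  ext α
  rw [coeff_weightedHomogeneousComponent]
  split_ifs with h
  · rw [← coeff_coe, hp, map_sum, coeff_sum]
    refine Finset.sum_congr rfl fun i _ => ?_
    rw [MvPowerSeries.coeff_mul, coeff_mul]
    refine Finset.sum_congr rfl fun q hq => ?_
    rw [coeff_coe]
    by_cases h0 : coeff q.2 (pderiv i f) = 0
    · rw [h0, mul_zero, mul_zero]
    · rw [hs, if_pos]
      have h2 := isWeightedHomogeneous_pderiv hf i h0
      rw [← Finset.HasAntidiagonal.mem_antidiagonal.1 hq, map_add] at h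
      omega
  · rw [coeff_sum]
    refine (Finset.sum_eq_zero fun i _ => ?_).symm
    refine ((hsh i).mul (isWeightedHomogeneous_pderiv hf i)).coeff_eq_zero α ?_
    rwa [sub_add_cancel]

theorem exists_homogeneous_combination_of_mem {w : Fin n → ℕ} (hw : ∀ i, 0 < w i) {d : ℕ}
    {f : MvPolynomial (Fin n) ℂ} (hf : IsWeightedHomogeneous w f d) {e : ℤ}
    {p : MvPolynomial (Fin n) ℂ} (hp : p ∈ polyJacobian f)
    (he : IsWeightedHomogeneous (intWeight w) p e) :
    ∃ s : Fin n → MvPolynomial (Fin n) ℂ,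
      (∀ i, IsWeightedHomogeneous (intWeight w) (s i) (e - (d - w i))) ∧
      p = ∑ i, s i * pderiv i f := by
  obtain ⟨c, hc⟩ := (Submodule.mem_span_range_iff_exists_fun _).1 hp
  obtain ⟨s, hs, h⟩ := exists_homogeneous_combination hw hf e p (fun i => (c i : MvPowerSeries _ _))
    (by
      rw [← hc, ← coeToMvPowerSeries.ringHom_apply, map_sum]
      simp only [smul_eq_mul, map_mul, coeToMvPowerSeries.ringHom_apply])
  exact ⟨s, hs, by rw [← h, he.weightedHomogeneousComponent_same]⟩

variable {f : MvPolynomial (Fin n) ℂ} {B : Set (Fin n →₀ ℕ)}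

theorem milnorMonomial_eq_mk (f : MvPolynomial (Fin n) ℂ) (α : Fin n →₀ ℕ) : milnorMonomial f α =
    Ideal.Quotient.mk (Ideal.span (Set.range fun i => polyToConv n (pderiv i f)))
      (polyToConv n (monomial α 1)) := rfl

theorem mk_polyToConv_eq_zero {p : MvPolynomial (Fin n) ℂ} (hp : p ∈ polyJacobian f) :
    (Ideal.Quotient.mk (Ideal.span (Set.range fun i => polyToConv n (pderiv i f)))
      (polyToConv n p) : MilnorAlgebra f) = 0 := by
  rw [Ideal.Quotient.eq_zero_iff_mem]
  have h := Ideal.mem_map_of_mem (polyToConv n) hp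
  rw [polyJacobian, Ideal.map_span, ← Set.range_comp] at h
  exact h

/-- The monomials of `B` are linearly independent modulo the Jacobian ideal of `ℂ[x]`. -/
theorem IsMonomialBasis.eq_zero_of_mem [Fintype B] (hB : IsMonomialBasis f B) (c : B → ℂ)
    (hc : ∑ α : B, c α • monomial (α : Fin n →₀ ℕ) (1 : ℂ) ∈ polyJacobian f) : c = 0 := by
  have h := mk_polyToConv_eq_zero hc
  rw [map_sum, map_sum] at h
  have h' : ∑ α : B, c α • milnorMonomial f α = 0 := by
    rw [← h]
    refine Finset.sum_congr rfl fun α _ => ?_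
    rw [map_smul, milnorMonomial_eq_mk]
    rfl
  exact funext (Fintype.linearIndependent_iff.1 hB.1 c h')

theorem IsMonomialBasis.monomial_notMem (hB : IsMonomialBasis f B) {α : Fin n →₀ ℕ} (hα : α ∈ B) :
    monomial α (1 : ℂ) ∉ polyJacobian f := fun h =>
  hB.1.ne_zero (⟨α, hα⟩ : B) (mk_polyToConv_eq_zero h)

/-- Graded division of monomials by the partial derivatives. -/
theorem IsMonomialBasis.exists_division [Fintype B] {w : Fin n → ℕ} (hw : ∀ i, 0 < w i) {d : ℕ}
    (hf : IsWeightedHomogeneous w f d) (hB : IsMonomialBasis f B) (γ : Fin n →₀ ℕ) :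
    ∃ (c : B → ℂ) (s : Fin n → MvPolynomial (Fin n) ℂ),
      (∀ α : B, c α ≠ 0 → Finsupp.weight w (α : Fin n →₀ ℕ) = Finsupp.weight w γ) ∧
      (∀ i, IsWeightedHomogeneous (intWeight w) (s i) (Finsupp.weight w γ - (d - w i))) ∧
      monomial γ 1 = ∑ α : B, c α • monomial (α : Fin n →₀ ℕ) (1 : ℂ) + ∑ i, s i * pderiv i f := by
  classical
  have hmem : milnorMonomial f γ ∈ Submodule.span ℂ (Set.range fun α : B => milnorMonomial f α) := by
    have : (Set.range fun α : B => milnorMonomial f α) = milnorMonomial f '' B := by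
      rw [Set.image_eq_range]
    rw [this, hB.2]
    trivial
  obtain ⟨c, hc⟩ := (Submodule.mem_span_range_iff_exists_fun _).1 hmem
  set p : MvPolynomial (Fin n) ℂ :=
    monomial γ 1 - ∑ α : B, c α • monomial (α : Fin n →₀ ℕ) (1 : ℂ) with hp
  have hpJ : polyToConv n p ∈
      Ideal.span (Set.range fun i => polyToConv n (pderiv i f)) := by
    rw [← Ideal.Quotient.eq_zero_iff_mem, hp, map_sub, map_sub, ← milnorMonomial_eq_mk, ← hc,
      map_sum, map_sum, sub_eq_zero]
    refine Finset.sum_congr rfl fun α _ => ?_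
    rw [map_smul, milnorMonomial_eq_mk]
    rfl
  obtain ⟨S, hS⟩ := (Submodule.mem_span_range_iff_exists_fun _).1 hpJ
  -- The division so far has convergent coefficients and mixes weights; its component of the weight
  -- of `γ` is polynomial and involves only basis monomials of that weight.
  obtain ⟨s, hs, h⟩ := exists_homogeneous_combination hw hf (Finsupp.weight w γ) p
    (fun i => (S i : MvPowerSeries (Fin n) ℂ)) (by
      rw [← coe_polyToConv, ← hS]
      have := map_sum (ConvSeries n).val (fun i => S i • polyToConv n (pderiv i f)) Finset.univ
      simp only [Subalgebra.coe_val] at this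
      rw [this]
      refine Finset.sum_congr rfl fun i _ => ?_
      rw [smul_eq_mul, MulMemClass.coe_mul, coe_polyToConv])
  refine ⟨fun α => if Finsupp.weight w (α : Fin n →₀ ℕ) = Finsupp.weight w γ then c α else 0, s,
    fun α hα => ?_, hs, ?_⟩
  · by_contra hne
    exact hα (if_neg hne)
  · rw [← h, hp, map_sub, map_sum, (isWeightedHomogeneous_monomial (intWeight w) γ 1
      (weight_intWeight w γ)).weightedHomogeneousComponent_same, add_sub_left_comm]
    rw [left_eq_add, ← Finset.sum_sub_distrib]
    refine Finset.sum_eq_zero fun α _ => ?_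
    rw [map_smul, weightedHomogeneousComponent_of_mem
      (isWeightedHomogeneous_monomial (intWeight w) _ 1 (weight_intWeight w _))]
    by_cases hαγ : Finsupp.weight w (α : Fin n →₀ ℕ) = Finsupp.weight w γ
    · simp [hαγ]
    · simp [hαγ, Ne.symm hαγ]

/-- A monomial divisible by $x_i^M$ vanishes in the Milnor algebra, so it cannot belong to a basis.
Thus `B` lies in a box. -/
theorem IsMonomialBasis.lt_of_mem (hB : IsMonomialBasis f B) {M : ℕ}
    (hM : ∀ i, (X i ^ M : MvPolynomial (Fin n) ℂ) ∈ polyJacobian f) {α : Fin n →₀ ℕ} (hα : α ∈ B)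
    (i : Fin n) : α i < M := by
  by_contra h
  refine hB.monomial_notMem hα ?_
  have hle : Finsupp.single i M ≤ α := by
    rw [Finsupp.single_le_iff]
    exact not_lt.1 h
  have : monomial α (1 : ℂ) = monomial (α - Finsupp.single i M) 1 * X i ^ M := by
    rw [X_pow_eq_monomial, monomial_mul, tsub_add_cancel_of_le hle, one_mul]
  rw [this]
  exact Ideal.mul_mem_left _ _ (hM i)

theorem IsMonomialBasis.finite (hB : IsMonomialBasis f B) {M : ℕ}
    (hM : ∀ i, (X i ^ M : MvPolynomial (Fin n) ℂ) ∈ polyJacobian f) : B.Finite :=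
  (Set.finite_Iic (Finsupp.equivFunOnFinite.symm fun _ : Fin n => M)).subset fun _ hα i =>
    (hB.lt_of_mem hM hα i).le

end Quasihomogeneous

/-! ### Bihomogeneous polynomials in `A₋[x]` -/

section Bihomogeneous

open MvPolynomial

variable {n k : ℕ} {w : Fin n → ℕ} {v : Fin k → ℤ}

/-- `p ∈ A₋[x]` is homogeneous of degree `e` in `x` and `t` together. -/
def IsBihom (w : Fin n → ℕ) (v : Fin k → ℤ) (p : MvPolynomial (Fin n) (Base k)) (e : ℤ) : Prop :=
  ∀ α, IsWeightedHomogeneous v (coeff α p) (e - Finsupp.weight w α)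

theorem IsBihom.isHomogeneousSeries {p : MvPolynomial (Fin n) (Base k)} {e : ℤ}
    (hp : IsBihom w v p e) : IsHomogeneousSeries w v (polyToRel n k p) e := by
  intro α
  rw [coe_polyToRel, coeff_coe]
  exact hp α

theorem IsBihom.add {p q : MvPolynomial (Fin n) (Base k)} {e : ℤ} (hp : IsBihom w v p e)
    (hq : IsBihom w v q e) : IsBihom w v (p + q) e := fun α => by
  rw [coeff_add]
  exact (hp α).add (hq α)

theorem IsBihom.neg {p : MvPolynomial (Fin n) (Base k)} {e : ℤ} (hp : IsBihom w v p e) :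
    IsBihom w v (-p) e := fun α => by
  rw [coeff_neg]
  exact (hp α).neg

theorem IsBihom.sum {ι : Type*} (s : Finset ι) (p : ι → MvPolynomial (Fin n) (Base k)) {e : ℤ}
    (hp : ∀ i ∈ s, IsBihom w v (p i) e) : IsBihom w v (∑ i ∈ s, p i) e := fun α => by
  rw [coeff_sum]
  exact IsWeightedHomogeneous.sum _ _ _ fun i hi => hp i hi α

theorem IsBihom.mul {p q : MvPolynomial (Fin n) (Base k)} {e e' : ℤ} (hp : IsBihom w v p e)
    (hq : IsBihom w v q e') : IsBihom w v (p * q) (e + e') := fun α => by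
  classical
  rw [coeff_mul]
  refine IsWeightedHomogeneous.sum _ _ _ fun x hx => ?_
  convert (hp x.1).mul (hq x.2) using 1
  rw [← Finset.HasAntidiagonal.mem_antidiagonal.1 hx, map_add]
  push_cast
  ring

theorem isBihom_monomial {a : Base k} {e : ℤ} (ha : IsWeightedHomogeneous v a e)
    (α : Fin n →₀ ℕ) {e' : ℤ} (he : e + Finsupp.weight w α = e') :
    IsBihom w v (monomial α a) e' := fun β => by
  classical
  rw [coeff_monomial]
  split_ifs with h
  · rw [← h, ← he, add_sub_cancel_right]
    exact ha
  · exact isWeightedHomogeneous_zero _ _ _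

theorem isBihom_monomial_one (α : Fin n →₀ ℕ) :
    IsBihom w v (monomial α (1 : Base k)) (Finsupp.weight w α) :=
  isBihom_monomial (isWeightedHomogeneous_one _ _) α (zero_add _)

theorem IsBihom.pderiv {p : MvPolynomial (Fin n) (Base k)} {e : ℤ} (hp : IsBihom w v p e)
    (i : Fin n) : IsBihom w v (pderiv i p) (e - w i) := fun α => by
  rw [coeff_pderiv]
  have h1 : IsWeightedHomogeneous v ((α i : Base k) + 1) 0 := by
    have := isWeightedHomogeneous_C v ((α i : ℂ) + 1)
    simpa using this
  convert (hp (α + Finsupp.single i 1)).mul h1 using 1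
  rw [map_add, Finsupp.weight_single]
  push_cast
  simp
  ring

theorem isBihom_map_C {p : MvPolynomial (Fin n) ℂ} {e : ℤ}
    (hp : IsWeightedHomogeneous (intWeight w) p e) :
    IsBihom w v (map C p : MvPolynomial (Fin n) (Base k)) e := fun α => by
  rw [coeff_map]
  by_cases h : coeff α p = 0
  · rw [h, C_0]
    exact isWeightedHomogeneous_zero _ _ _
  · rw [← hp h, weight_intWeight, sub_self]
    exact isWeightedHomogeneous_C _ _

end Bihomogeneous

/-! ### Division by the partial derivatives of the unfolding -/

section Division

open MvPolynomial

variable {n k : ℕ}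

/-- The data of the family: a quasihomogeneous polynomial `f₀` of positive degree, a monomial basis of
its Milnor algebra, an enumeration of the upper monomials, and an exponent `M` such that all `xᵢ^M`
lie in the Jacobian ideal. -/
structure FamilyData (w : Fin n → ℕ) (d : ℕ) (f₀ : MvPolynomial (Fin n) ℂ) (B : Set (Fin n →₀ ℕ))
    (m : Fin k → (Fin n →₀ ℕ)) (M : ℕ) : Prop where
  weight_pos : ∀ i, 0 < w i
  degree_ne_zero : d ≠ 0
  homogeneous : IsWeightedHomogeneous w f₀ d
  basis : IsMonomialBasis f₀ B
  upper : EnumeratesUpper w d B m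
  pow_mem : ∀ i, (X i ^ M : MvPolynomial (Fin n) ℂ) ∈ polyJacobian f₀

variable {w : Fin n → ℕ} {d : ℕ} {f₀ : MvPolynomial (Fin n) ℂ} {B : Set (Fin n →₀ ℕ)}
  {m : Fin k → (Fin n →₀ ℕ)} {M : ℕ}

theorem FamilyData.lt_weight (D : FamilyData w d f₀ B m M) (j : Fin k) :
    d < Finsupp.weight w (m j) := by
  have hj : m j ∈ {α | α ∈ B ∧ d < Finsupp.weight w α} := D.upper.range_eq ▸ Set.mem_range_self j
  exact hj.2

theorem FamilyData.mem_basis (D : FamilyData w d f₀ B m M) (j : Fin k) : m j ∈ B := by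
  have hj : m j ∈ {α | α ∈ B ∧ d < Finsupp.weight w α} := D.upper.range_eq ▸ Set.mem_range_self j
  exact hj.1

/-- The deformation term `∑ t_j m_j`. -/
def deformation (m : Fin k → (Fin n →₀ ℕ)) : MvPolynomial (Fin n) (Base k) :=
  ∑ j, monomial (m j) (X j : Base k)

theorem unfoldingPoly_eq (f₀ : MvPolynomial (Fin n) ℂ) (m : Fin k → (Fin n →₀ ℕ)) :
    unfoldingPoly f₀ m = map C f₀ + deformation m := rfl

theorem isBihom_deformation (w : Fin n → ℕ) (d : ℕ) (m : Fin k → (Fin n →₀ ℕ)) :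
    IsBihom w (tWeight w d m) (deformation m) d :=
  IsBihom.sum _ _ fun j _ => isBihom_monomial (isWeightedHomogeneous_X _ _ j) _ (by simp [tWeight])

theorem FamilyData.isBihom_unfoldingPoly (D : FamilyData w d f₀ B m M) :
    IsBihom w (tWeight w d m) (unfoldingPoly f₀ m) d :=
  (isBihom_map_C (isWeightedHomogeneous_intWeight D.homogeneous)).add (isBihom_deformation w d m)

theorem FamilyData.lt_weight_of_deformation (D : FamilyData w d f₀ B m M) {α : Fin n →₀ ℕ}
    (hα : coeff α (deformation m) ≠ 0) : d < Finsupp.weight w α := by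
  classical
  rw [deformation, coeff_sum] at hα
  obtain ⟨j, _, hj⟩ := Finset.exists_ne_zero_of_sum_ne_zero hα
  rw [coeff_monomial] at hj
  have : m j = α := by
    by_contra h
    exact hj (if_neg h)
  rw [← this]
  exact D.lt_weight j

theorem coeff_mul_ne_zero_imp {S : Type*} [CommRing S] {p q : MvPolynomial (Fin n) S}
    {α : Fin n →₀ ℕ} (h : coeff α (p * q) ≠ 0) :
    ∃ β γ, β + γ = α ∧ coeff β p ≠ 0 ∧ coeff γ q ≠ 0 := by
  classical
  rw [coeff_mul] at h
  obtain ⟨x, hx, hne⟩ := Finset.exists_ne_zero_of_sum_ne_zero h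
  exact ⟨x.1, x.2, Finset.HasAntidiagonal.mem_antidiagonal.1 hx, left_ne_zero_of_mul hne,
    right_ne_zero_of_mul hne⟩

theorem polyToRel_mem_xIdeal {p : MvPolynomial (Fin n) (Base k)} (hp : coeff 0 p = 0) :
    polyToRel n k p ∈ xIdeal n k :=
  mem_xIdeal_of_coeff_zero (by rw [coe_polyToRel, coeff_coe, hp])

/-- The remainder of the division of a monomial by the partial derivatives of `f₀`, as a division
by those of `F`. -/
theorem FamilyData.exists_lift (D : FamilyData w d f₀ B m M) {e : ℕ}
    (s : Fin n → MvPolynomial (Fin n) ℂ)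
    (hs : ∀ i, IsWeightedHomogeneous (intWeight w) (s i) (e - (d - w i))) :
    (d ≤ e → ∀ i, polyToRel n k (map C (s i)) ∈ xIdeal n k) ∧
    IsBihom w (tWeight w d m) (∑ i, map C (s i) * pderiv i (deformation m)) e ∧
    (∀ α, coeff α (∑ i, map C (s i) * pderiv i (deformation m)) ≠ 0 → e < Finsupp.weight w α) ∧
    map C (∑ i, s i * pderiv i f₀) = ∑ i, map C (s i) * pderiv i (unfoldingPoly f₀ m) -
      ∑ i, map C (s i) * pderiv i (deformation m) := by
  classical
  refine ⟨fun hde i => polyToRel_mem_xIdeal ?_, IsBihom.sum _ _ fun i _ => ?_, fun α hα => ?_, ?_⟩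
  -- For `d ≤ e` the degree of `s i` is at least `w i > 0`, so there is no constant term.
  · rw [coeff_map, (hs i).coeff_eq_zero, C_0]
    rw [map_zero]
    have := D.weight_pos i
    omega
  · convert (isBihom_map_C (hs i)).mul ((isBihom_deformation w d m).pderiv i) using 1
    ring
  -- The deformation has only monomials of weight above `d`, so trading $\partial_if_0$ for its
  -- derivative strictly raises the weight.
  · rw [coeff_sum] at hα
    obtain ⟨i, _, hi⟩ := Finset.exists_ne_zero_of_sum_ne_zero hα
    obtain ⟨β, γ, rfl, hβ, hγ⟩ := coeff_mul_ne_zero_imp hi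
    rw [coeff_map] at hβ
    have h1 := hs i (d := β) (fun h => hβ (by rw [h, C_0]))
    rw [coeff_pderiv] at hγ
    have h2 := D.lt_weight_of_deformation (left_ne_zero_of_mul hγ)
    rw [map_add, Finsupp.weight_single, one_smul] at h2
    rw [weight_intWeight] at h1
    rw [map_add]
    omega
  · rw [map_sum, ← Finset.sum_sub_distrib]
    refine Finset.sum_congr rfl fun i _ => ?_
    rw [map_mul, unfoldingPoly_eq, map_add, ← mul_sub, add_sub_cancel_right, pderiv_map]

/-- A bound for the weights of the monomial basis and for `d`. -/
def weightBound (w : Fin n → ℕ) (d M : ℕ) : ℕ := M * ∑ i, w i + d + 1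

theorem FamilyData.weight_lt_bound (D : FamilyData w d f₀ B m M) {α : Fin n →₀ ℕ} (hα : α ∈ B) :
    Finsupp.weight w α < weightBound w d M := by
  rw [Finsupp.weight_eq_sum, weightBound, Finset.mul_sum]
  have : ∑ i, α i • w i ≤ ∑ i, M * w i :=
    Finset.sum_le_sum fun i _ => Nat.mul_le_mul_right _ (D.basis.lt_of_mem D.pow_mem hα i).le
  omega

/-! ### The weight filtration and Nakayama's lemma -/

/-- The ideal of `A₋[x]` generated by the monomials of weight at least `e`. -/
def weightIdeal (k : ℕ) (w : Fin n → ℕ) (e : ℕ) : Ideal (MvPolynomial (Fin n) (Base k)) :=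
  Ideal.span ((fun γ => monomial γ 1) '' {γ | e ≤ Finsupp.weight w γ})

theorem mem_weightIdeal {p : MvPolynomial (Fin n) (Base k)} {e : ℕ}
    (hp : ∀ α, coeff α p ≠ 0 → e ≤ Finsupp.weight w α) : p ∈ weightIdeal k w e := by
  rw [weightIdeal, mem_ideal_span_monomial_image]
  exact fun α hα => ⟨α, hp α (mem_support_iff.1 hα), le_rfl⟩

/-- `(x) (∂F/∂x₁, …, ∂F/∂xₙ)`. -/
def smallJacobian (f₀ : MvPolynomial (Fin n) ℂ) (m : Fin k → (Fin n →₀ ℕ)) :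
    Ideal (RelSeries n k) := xIdeal n k * relJacobian f₀ m

theorem polyToRel_pderiv_mem (i : Fin n) :
    polyToRel n k (pderiv i (unfoldingPoly f₀ m)) ∈ relJacobian f₀ m :=
  Ideal.subset_span ⟨i, rfl⟩

theorem polyToRel_sum_mem_smallJacobian {S : Fin n → MvPolynomial (Fin n) (Base k)}
    (hS : ∀ i, polyToRel n k (S i) ∈ xIdeal n k) :
    polyToRel n k (∑ i, S i * pderiv i (unfoldingPoly f₀ m)) ∈ smallJacobian f₀ m := by
  rw [map_sum]
  refine Ideal.sum_mem _ fun i _ => ?_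
  rw [map_mul]
  exact Ideal.mul_mem_mul (hS i) (polyToRel_pderiv_mem i)

/-- Beyond the bound there are no basis monomials, so division leaves no remainder; passing from
$f_0$ to $F$ costs only terms of larger weight. -/
theorem FamilyData.weightIdeal_le_succ [Fintype B] (D : FamilyData w d f₀ B m M) {e : ℕ}
    (he : weightBound w d M ≤ e) : (weightIdeal k w e).map (polyToRel n k) ≤
      smallJacobian f₀ m ⊔ (weightIdeal k w (e + 1)).map (polyToRel n k) := by
  rw [weightIdeal, Ideal.map_span, Ideal.span_le]
  rintro _ ⟨_, ⟨γ, hγ, rfl⟩, rfl⟩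
  have hγ : e ≤ Finsupp.weight w γ := hγ
  obtain ⟨c, s, hc, hs, h⟩ := D.basis.exists_division D.weight_pos D.homogeneous γ
  obtain ⟨h1, -, h3, h4⟩ := D.exists_lift s hs
  have hc0 : ∀ α, c α = 0 := fun α => by
    by_contra hne
    have := hc α hne
    have := D.weight_lt_bound α.2
    omega
  have hγ1 : (monomial γ 1 : MvPolynomial (Fin n) (Base k)) = map C (monomial γ (1 : ℂ)) := by
    rw [map_monomial, C_1]
  have hde : d ≤ Finsupp.weight w γ := by
    rw [weightBound] at he
    omega
  rw [SetLike.mem_coe]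
  simp only [hγ1]
  rw [h]
  simp only [hc0, zero_smul, Finset.sum_const_zero, zero_add]
  rw [h4, map_sub]
  refine Ideal.sub_mem _ (Ideal.mem_sup_left (polyToRel_sum_mem_smallJacobian (h1 hde)))
    (Ideal.mem_sup_right (Ideal.mem_map_of_mem _ (mem_weightIdeal fun α hα => ?_)))
  have := h3 α hα
  omega

theorem FamilyData.weightIdeal_le_add [Fintype B] (D : FamilyData w d f₀ B m M) (N : ℕ) :
    (weightIdeal k w (weightBound w d M)).map (polyToRel n k) ≤
      smallJacobian f₀ m ⊔ (weightIdeal k w (weightBound w d M + N)).map (polyToRel n k) := by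
  induction N with
  | zero => exact le_sup_right
  | succ N ih =>
    refine ih.trans (sup_le le_sup_left ?_)
    exact D.weightIdeal_le_succ (Nat.le_add_right _ _)

/-- Removing one variable lowers the weight by at most $\sum_i w_i$. The resulting factor from $(x)$
is what Nakayama's lemma needs. -/
theorem weightIdeal_add_le (e : ℕ) :
    (weightIdeal k w (e + ((∑ i, w i) + 1))).map (polyToRel n k) ≤
      xIdeal n k • (weightIdeal k w e).map (polyToRel n k) := by
  rw [weightIdeal, Ideal.map_span, Ideal.span_le]
  rintro _ ⟨_, ⟨γ, hγ, rfl⟩, rfl⟩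
  have hγ : e + ((∑ i, w i) + 1) ≤ Finsupp.weight w γ := hγ
  have hγ0 : γ ≠ 0 := by
    rintro rfl
    rw [map_zero] at hγ
    omega
  obtain ⟨i, hi⟩ := Finsupp.ne_iff.1 hγ0
  have hwt := Finsupp.weight_sub_single_add (w := w) hi
  have hwi : w i ≤ ∑ i, w i :=
    Finset.single_le_sum (f := w) (fun _ _ => Nat.zero_le _) (Finset.mem_univ i)
  have : (monomial γ 1 : MvPolynomial (Fin n) (Base k)) =
      X i * monomial (γ - Finsupp.single i 1) 1 := by
    rw [X, monomial_mul, one_mul, add_comm, tsub_add_cancel_of_le]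
    rw [Finsupp.single_le_iff]
    exact Nat.one_le_iff_ne_zero.2 hi
  rw [SetLike.mem_coe]
  simp only [this]
  rw [map_mul]
  refine Ideal.mul_mem_mul (Ideal.subset_span ⟨i, rfl⟩)
    (Ideal.mem_map_of_mem _ (Ideal.subset_span ⟨_, ?_, rfl⟩))
  change e ≤ _
  omega

/-- Monomials of large weight lie in `(x) (∂F/∂x₁, …, ∂F/∂xₙ)`. -/
theorem FamilyData.weightIdeal_le [Fintype B] (D : FamilyData w d f₀ B m M) :
    (weightIdeal k w (weightBound w d M)).map (polyToRel n k) ≤ smallJacobian f₀ m := by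
  -- Finite generation comes from the noetherian ring $A_-[x]$, where the monomial ideal is defined;
  -- nothing is needed about $A_-\{x\}$ itself.
  refine Submodule.le_of_le_smul_of_le_jacobson_bot (I := xIdeal n k) ?_ xIdeal_le_jacobson ?_
  · exact Ideal.FG.map (IsNoetherian.noetherian _) _
  · refine (D.weightIdeal_le_add ((∑ i, w i) + 1)).trans (sup_le le_sup_left ?_)
    exact (weightIdeal_add_le _).trans le_sup_right

/-- Weights are at least 1, so weight dominates degree. It lets convergent series be replaced by
polynomials. -/
theorem FamilyData.xIdeal_pow_le [Fintype B] (D : FamilyData w d f₀ B m M) :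
    xIdeal n k ^ weightBound w d M ≤ smallJacobian f₀ m := by
  refine le_trans ?_ D.weightIdeal_le
  have h : ∀ N, xIdeal n k ^ N ≤ (weightIdeal k w N).map (polyToRel n k) := by
    intro N
    have hx : xIdeal n k = (idealOfVars (Fin n) (Base k)).map (polyToRel n k) := by
      rw [idealOfVars, Ideal.map_span, xIdeal, ← Set.range_comp]
      rfl
    rw [hx, ← Ideal.map_pow]
    refine Ideal.map_mono fun p hp => mem_weightIdeal fun α hα => ?_
    have := (mem_pow_idealOfVars_iff N p).1 hp α (mem_support_iff.2 hα)
    refine this.trans ?_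
    rw [Finsupp.degree_eq_sum, Finsupp.weight_eq_sum]
    exact Finset.sum_le_sum fun i _ => Nat.le_mul_of_pos_right _ (D.weight_pos i)
  exact h _

/-! ### Normal forms with respect to the monomial basis -/

/-- Modulo the ideal `L`, the polynomial `p` is a combination of the basis monomials of weight `≥ o`
whose coefficients make it homogeneous of degree `e`. -/
def HasNormalForm [Fintype B] (w : Fin n → ℕ) (v : Fin k → ℤ) (L : Ideal (RelSeries n k)) (e : ℤ)
    (o : ℕ) (p : MvPolynomial (Fin n) (Base k)) : Prop :=
  ∃ a : B → Base k, (∀ α : B, IsWeightedHomogeneous v (a α) (e - Finsupp.weight w α.1)) ∧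
    (∀ α : B, a α ≠ 0 → o ≤ Finsupp.weight w α.1) ∧
    polyToRel n k (p - ∑ α : B, monomial α.1 (a α)) ∈ L

theorem HasNormalForm.zero [Fintype B] {v : Fin k → ℤ} {L : Ideal (RelSeries n k)} {e : ℤ} {o : ℕ} :
    HasNormalForm (B := B) w v L e o 0 :=
  ⟨0, fun _ => isWeightedHomogeneous_zero _ _ _, fun _ h => absurd rfl h, by simp⟩

theorem HasNormalForm.add [Fintype B] {v : Fin k → ℤ} {L : Ideal (RelSeries n k)} {e : ℤ} {o : ℕ}
    {p q : MvPolynomial (Fin n) (Base k)} (hp : HasNormalForm (B := B) w v L e o p)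
    (hq : HasNormalForm (B := B) w v L e o q) : HasNormalForm (B := B) w v L e o (p + q) := by
  obtain ⟨a, ha, ha', hpa⟩ := hp
  obtain ⟨b, hb, hb', hqb⟩ := hq
  refine ⟨a + b, fun α => (ha α).add (hb α), fun α hα => ?_, ?_⟩
  · by_cases h : a α = 0
    · exact hb' α fun h' => hα (by simp [h, h'])
    · exact ha' α h
  · simp only [Pi.add_apply, map_add, Finset.sum_add_distrib]
    rw [add_sub_add_comm, map_add]
    exact Ideal.add_mem _ hpa hqb

theorem HasNormalForm.sum [Fintype B] {v : Fin k → ℤ} {L : Ideal (RelSeries n k)} {e : ℤ} {o : ℕ}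
    {ι : Type*} (s : Finset ι) (p : ι → MvPolynomial (Fin n) (Base k))
    (hp : ∀ i ∈ s, HasNormalForm (B := B) w v L e o (p i)) :
    HasNormalForm (B := B) w v L e o (∑ i ∈ s, p i) := by
  classical
  induction s using Finset.induction_on with
  | empty => exact HasNormalForm.zero
  | insert i s hi ih =>
    rw [Finset.sum_insert hi]
    exact (hp i (Finset.mem_insert_self _ _)).add
      (ih fun j hj => hp j (Finset.mem_insert_of_mem hj))

theorem HasNormalForm.smul [Fintype B] {v : Fin k → ℤ} {L : Ideal (RelSeries n k)} {e e' : ℤ}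
    {o o' : ℕ} (ho : o' ≤ o) {p : MvPolynomial (Fin n) (Base k)}
    (hp : HasNormalForm (B := B) w v L e o p)
    {b : Base k} (hb : IsWeightedHomogeneous v b (e' - e)) :
    HasNormalForm (B := B) w v L e' o' (b • p) := by
  obtain ⟨a, ha, ha', hpa⟩ := hp
  refine ⟨b • a, fun α => ?_, fun α hα => ho.trans (ha' α fun h => hα (by simp [h])), ?_⟩
  · have h := hb.mul (ha α)
    rwa [sub_add_sub_cancel] at h
  · have : b • p - ∑ α : B, monomial α.1 ((b • a) α) = b • (p - ∑ α : B, monomial α.1 (a α)) := by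
      rw [smul_sub, Finset.smul_sum]
      simp only [Pi.smul_apply, smul_monomial]
    rw [this, map_smul]
    exact Submodule.smul_of_tower_mem L b hpa

theorem HasNormalForm.of_monomials [Fintype B] {v : Fin k → ℤ} {L : Ideal (RelSeries n k)} {e : ℤ}
    {o : ℕ} {p : MvPolynomial (Fin n) (Base k)} (hp : IsBihom w v p e)
    (ho : ∀ α, coeff α p ≠ 0 → o ≤ Finsupp.weight w α)
    (h : ∀ α, coeff α p ≠ 0 → HasNormalForm (B := B) w v L (Finsupp.weight w α)
      (Finsupp.weight w α) (monomial α 1)) :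
    HasNormalForm (B := B) w v L e o p := by
  rw [p.as_sum]
  refine HasNormalForm.sum _ _ fun α hα => ?_
  rw [mem_support_iff] at hα
  have : monomial α (coeff α p) = coeff α p • monomial α (1 : Base k) := by
    rw [smul_monomial, smul_eq_mul, mul_one]
  rw [this]
  exact (h α hα).smul (ho α hα) (hp α)

/-- Downward induction on the weight: each division yields basis monomials of the same weight plus
an error of larger weight, and beyond the bound everything lies in $(x)J_F$. The alternative `hγ`
separates working modulo all of $J_F$ from working modulo $(x)J_F$; in the latter case weight at
least `d` keeps the quotients in $(x)$. -/
theorem FamilyData.hasNormalForm_monomial [Fintype B] (D : FamilyData w d f₀ B m M)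
    {L : Ideal (RelSeries n k)} (hL : smallJacobian f₀ m ≤ L) (γ : Fin n →₀ ℕ)
    (hγ : relJacobian f₀ m ≤ L ∨ d ≤ Finsupp.weight w γ) :
    HasNormalForm (B := B) w (tWeight w d m) L (Finsupp.weight w γ) (Finsupp.weight w γ)
      (monomial γ 1) := by
  induction hN : weightBound w d M - Finsupp.weight w γ using Nat.strong_induction_on
    generalizing γ with
  | _ N ih =>
  subst hN
  by_cases hbig : weightBound w d M ≤ Finsupp.weight w γ
  · refine ⟨0, fun _ => isWeightedHomogeneous_zero _ _ _, fun _ h => absurd rfl h, hL ?_⟩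
    simp only [Pi.zero_apply, map_zero, Finset.sum_const_zero, sub_zero]
    exact D.weightIdeal_le (Ideal.mem_map_of_mem _ (Ideal.subset_span ⟨γ, hbig, rfl⟩))
  obtain ⟨c, s, hc, hs, h⟩ := D.basis.exists_division D.weight_pos D.homogeneous γ
  obtain ⟨h1, h2, h3, h4⟩ := D.exists_lift s hs
  have hγ1 : (monomial γ 1 : MvPolynomial (Fin n) (Base k)) =
      (∑ α : B, monomial α.1 (C (c α)) + ∑ i, map C (s i) * pderiv i (unfoldingPoly f₀ m)) +
        -∑ i, map C (s i) * pderiv i (deformation m) := by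
    rw [add_assoc, ← sub_eq_add_neg, ← h4]
    have := congrArg (map (C : ℂ →+* Base k)) h
    rw [map_monomial, C_1] at this
    rw [this, map_add, map_sum]
    congr 1
    refine Finset.sum_congr rfl fun α _ => ?_
    rw [smul_monomial, map_monomial, smul_eq_mul, mul_one]
  rw [hγ1]
  refine HasNormalForm.add ?_ ?_
  · refine ⟨fun α => C (c α), fun α => ?_, fun α hα => ?_, ?_⟩
    · by_cases hcα : c α = 0
      · simp only [hcα, C_0]
        exact isWeightedHomogeneous_zero _ _ _
      · rw [hc α hcα, sub_self]
        exact isWeightedHomogeneous_C _ _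
    · exact (hc α fun h => hα (by simp only [h, C_0])).ge
    · rw [add_sub_cancel_left]
      rcases hγ with hγ | hγ
      · rw [map_sum]
        refine Ideal.sum_mem _ fun i _ => ?_
        rw [map_mul]
        exact Ideal.mul_mem_left _ _ (hγ (polyToRel_pderiv_mem i))
      · exact hL (polyToRel_sum_mem_smallJacobian (h1 hγ))
  · refine HasNormalForm.of_monomials h2.neg (fun α hα => ?_) fun α hα => ?_
    · rw [coeff_neg, neg_ne_zero] at hα
      exact (h3 α hα).le
    · rw [coeff_neg, neg_ne_zero] at hα
      have := h3 α hα
      exact ih _ (by omega) α (hγ.imp id fun h => by omega) rfl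

theorem FamilyData.hasNormalForm [Fintype B] (D : FamilyData w d f₀ B m M)
    {L : Ideal (RelSeries n k)} (hL : smallJacobian f₀ m ≤ L)
    {p : MvPolynomial (Fin n) (Base k)} {e : ℤ} {o : ℕ} (hp : IsBihom w (tWeight w d m) p e)
    (ho : ∀ α, coeff α p ≠ 0 → o ≤ Finsupp.weight w α) (hLo : relJacobian f₀ m ≤ L ∨ d ≤ o) :
    HasNormalForm (B := B) w (tWeight w d m) L e o p :=
  HasNormalForm.of_monomials hp ho fun α hα =>
    D.hasNormalForm_monomial hL α (hLo.imp id fun h => h.trans (ho α hα))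

end Division

/-! ### The residue functional -/

section Residue

open MvPolynomial

theorem isWeightedHomogeneous_det {σ ι S : Type*} [CommRing S] [Fintype ι] [DecidableEq ι]
    {v : σ → ℤ} (A : Matrix ι ι (MvPolynomial σ S)) (a b : ι → ℤ)
    (hA : ∀ i j, IsWeightedHomogeneous v (A i j) (a i + b j)) :
    IsWeightedHomogeneous v A.det (∑ i, a i + ∑ j, b j) := by
  rw [Matrix.det_apply]
  refine IsWeightedHomogeneous.sum _ _ _ fun τ _ => ?_
  have h := IsWeightedHomogeneous.prod Finset.univ (fun i => A (τ i) i) _ fun i _ => hA (τ i) i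
  rw [Finset.sum_add_distrib, Equiv.sum_comp τ a] at h
  rcases Int.units_eq_one_or (Equiv.Perm.sign τ) with h1 | h1
  · rw [h1, one_smul]
    exact h
  · rw [h1, Units.neg_smul, one_smul]
    exact h.neg

variable {n k : ℕ}

/-- The exponent `(M - 1, …, M - 1)`. -/
def topExponent (n M : ℕ) : Fin n →₀ ℕ := Finsupp.equivFunOnFinite.symm fun _ => M - 1

theorem coeff_topExponent_mul_X_pow {S : Type*} [CommRing S] {M : ℕ} (hM : 0 < M)
    (g : MvPowerSeries (Fin n) S) (i : Fin n) :
    MvPowerSeries.coeff (topExponent n M) (g * MvPowerSeries.X i ^ M) = 0 := by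
  classical
  rw [MvPowerSeries.X_pow_eq, MvPowerSeries.coeff_mul_monomial, if_neg]
  rw [Finsupp.single_le_iff]
  simp only [topExponent, Finsupp.equivFunOnFinite_symm_apply_apply]
  omega

theorem det_mul_eq_sum_adjugate {S : Type*} [CommRing S] (A : Matrix (Fin n) (Fin n) S)
    (b : Fin n → S) (j : Fin n) : A.det * b j = ∑ i, A.adjugate j i * A.mulVec b i := by
  have h : A.adjugate.mulVec (A.mulVec b) = A.det • b := by
    rw [Matrix.mulVec_mulVec, Matrix.adjugate_mul, Matrix.smul_mulVec, Matrix.one_mulVec]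
  exact (congrFun h j).symm

/-- The functional `p ↦ coefficient of x^(M-1, …, M-1) in det(A) p`. -/
def topFunctional (M : ℕ) (A : Matrix (Fin n) (Fin n) (MvPolynomial (Fin n) ℂ)) :
    MvPolynomial (Fin n) ℂ →ₗ[ℂ] ℂ :=
  (lcoeff ℂ (topExponent n M)).comp (LinearMap.mulLeft ℂ A.det)

theorem topFunctional_apply (M : ℕ) (A : Matrix (Fin n) (Fin n) (MvPolynomial (Fin n) ℂ))
    (p : MvPolynomial (Fin n) ℂ) : topFunctional M A p = coeff (topExponent n M) (A.det * p) := rfl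

/-- By Cramer's rule $\det(A)\,\partial_jf$ lies in $(x_1^M,\dots,x_n^M)$, and no element of that
ideal involves $x^{(M-1,\dots,M-1)}$. -/
theorem topFunctional_eq_zero_of_mem {f : MvPolynomial (Fin n) ℂ} {M : ℕ} (hM : 0 < M)
    {A : Matrix (Fin n) (Fin n) (MvPolynomial (Fin n) ℂ)}
    (hA : ∀ i, ∑ j, A i j * pderiv j f = X i ^ M) {p : MvPolynomial (Fin n) ℂ}
    (hp : p ∈ polyJacobian f) : topFunctional M A p = 0 := by
  obtain ⟨c, rfl⟩ := (Submodule.mem_span_range_iff_exists_fun _).1 hp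
  rw [map_sum]
  refine Finset.sum_eq_zero fun j _ => ?_
  rw [topFunctional_apply, smul_eq_mul, mul_left_comm,
    det_mul_eq_sum_adjugate A (fun j => pderiv j f) j, Finset.mul_sum, coeff_sum]
  refine Finset.sum_eq_zero fun i _ => ?_
  rw [show A.mulVec (fun j => pderiv j f) i = X i ^ M from hA i, ← mul_assoc, ← coeff_coe, coe_mul,
    coe_pow, coe_X, coeff_topExponent_mul_X_pow hM]

/-- Pairing with all monomials shows that $\det(A)z$ has no monomial with all exponents below `M`,
so it lies in $(x_1^M,\dots,x_n^M)$. The theorem on transition determinants then removes $\det A$.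
-/
theorem mem_polyJacobian_of_topFunctional {f : MvPolynomial (Fin n) ℂ} {M : ℕ}
    {A : Matrix (Fin n) (Fin n) (MvPolynomial (Fin n) ℂ)}
    (hA : ∀ i, ∑ j, A i j * pderiv j f = X i ^ M) {z : MvPolynomial (Fin n) ℂ}
    (hz : ∀ α, topFunctional M A (monomial α 1 * z) = 0) : z ∈ polyJacobian f := by
  classical
  refine mem_span_of_det_mul_mem _ _ A (funext hA) (isRegSeq_X_pow M) z ?_
  have himg : Set.range (fun i : Fin n => (X i ^ M : MvPolynomial (Fin n) ℂ)) =
      (fun s => monomial s (1 : ℂ)) '' Set.range fun j => Finsupp.single j M := by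
    rw [← Set.range_comp]
    congr 1
    funext j
    rw [X_pow_eq_monomial]; rfl
  rw [himg, mem_ideal_span_monomial_image]
  intro α hα
  by_contra! h
  have hle : α ≤ topExponent n M := by
    intro i
    have := h _ ⟨i, rfl⟩
    rw [Finsupp.single_le_iff] at this
    simp only [topExponent, Finsupp.equivFunOnFinite_symm_apply_apply]
    omega
  -- The complementary monomial reads off the coefficient of $x^\alpha$ in $\det(A)z$.
  have := hz (topExponent n M - α)
  rw [topFunctional_apply, mul_left_comm, coeff_monomial_mul', if_pos tsub_le_self, one_mul,
    tsub_tsub_cancel_of_le hle] at this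
  exact mem_support_iff.1 hα this

variable {w : Fin n → ℕ} {d : ℕ} {f₀ : MvPolynomial (Fin n) ℂ} {B : Set (Fin n →₀ ℕ)}
  {m : Fin k → (Fin n →₀ ℕ)} {M : ℕ}

theorem smallJacobian_le (f₀ : MvPolynomial (Fin n) ℂ) (m : Fin k → (Fin n →₀ ℕ)) :
    smallJacobian f₀ m ≤ relJacobian f₀ m := by
  rw [smallJacobian, Ideal.mul_le]
  exact fun _ _ _ hs => Ideal.mul_mem_left _ _ hs

/-- Specialization of a series to `t = 0`. -/
def specialize (n k : ℕ) : RelSeries n k →+* MvPowerSeries (Fin n) ℂ :=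
  (MvPowerSeries.map (eval 0)).comp (toSeries n k).toRingHom

theorem specialize_apply (g : RelSeries n k) :
    specialize n k g = MvPowerSeries.map (eval 0) (toSeries n k g) := rfl

theorem specialize_map_C (p : MvPolynomial (Fin n) ℂ) :
    specialize n k (polyToRel n k (map C p)) = (p : MvPowerSeries (Fin n) ℂ) := by
  ext α
  rw [specialize_apply, coe_polyToRel, MvPowerSeries.coeff_map, coeff_coe, coeff_coe, coeff_map,
    eval_C]

theorem specialize_X_smul (l : Fin k) (g : RelSeries n k) :
    specialize n k ((X l : Base k) • g) = 0 := by
  ext α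
  rw [specialize_apply, map_smul, MvPowerSeries.coeff_map, map_smul, smul_eq_mul, map_mul]
  simp

/-- Powers of the variables as combinations of the partial derivatives of `F`, extending given such
expressions at `t = 0`. -/
theorem FamilyData.exists_rel_matrix [Fintype B] (D : FamilyData w d f₀ B m M) {M' : ℕ}
    (hM' : weightBound w d M ≤ M') {A : Matrix (Fin n) (Fin n) (MvPolynomial (Fin n) ℂ)}
    (hA : ∀ i, ∑ j, A i j * pderiv j f₀ = X i ^ M')
    (hAh : ∀ i j, IsWeightedHomogeneous (intWeight w) (A i j) ((M' * w i : ℕ) - (d - w j))) :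
    ∃ A' : Matrix (Fin n) (Fin n) (RelSeries n k),
      (∀ i, ∑ j, A' i j * polyToRel n k (pderiv j (unfoldingPoly f₀ m)) =
        polyToRel n k (X i ^ M')) ∧
      ∀ i j, specialize n k (A' i j) = A i j := by
  classical
  have hmem : ∀ i l, polyToRel n k (∑ j, map C (A i j) * pderiv j (monomial (m l) (1 : Base k))) ∈
      relJacobian f₀ m := by
    intro i l
    -- The error $\sum_jA_{ij}\,\partial_jm_l$ has weight above $M'w_i$, as $\deg m_l>d$; hence it
    -- is itself a combination of the derivatives of $F$.
    refine smallJacobian_le f₀ m (D.weightIdeal_le (Ideal.mem_map_of_mem _ ?_))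
    refine mem_weightIdeal fun α hα => ?_
    rw [coeff_sum] at hα
    obtain ⟨j, _, hj⟩ := Finset.exists_ne_zero_of_sum_ne_zero hα
    obtain ⟨β, γ, rfl, hβ, hγ⟩ := coeff_mul_ne_zero_imp hj
    rw [coeff_map] at hβ
    have h1 := hAh i j (d := β) (fun h => hβ (by rw [h, C_0]))
    rw [coeff_pderiv] at hγ
    have h2 := left_ne_zero_of_mul hγ
    rw [coeff_monomial] at h2
    have h3 : m l = γ + Finsupp.single j 1 := by
      by_contra h
      exact h2 (if_neg h)
    have h4 := D.lt_weight l
    rw [h3, map_add, Finsupp.weight_single, one_smul] at h4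
    rw [weight_intWeight] at h1
    rw [map_add]
    have h5 : M' ≤ M' * w i := Nat.le_mul_of_pos_right _ (D.weight_pos i)
    omega
  choose G hG using fun i l => (Submodule.mem_span_range_iff_exists_fun _).1 (hmem i l)
  -- The corrections carry a factor $t_l$, so they disappear at $t=0$.
  refine ⟨fun i j => polyToRel n k (map C (A i j)) - ∑ l, (X l : Base k) • G i l j, fun i => ?_,
    fun i j => ?_⟩
  · have h1 : (X i ^ M' : MvPolynomial (Fin n) (Base k)) =
        ∑ j, map C (A i j) * pderiv j (unfoldingPoly f₀ m) -
          ∑ l, (X l : Base k) • ∑ j, map C (A i j) * pderiv j (monomial (m l) (1 : Base k)) := by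
      have h := congrArg (map (C : ℂ →+* Base k)) (hA i)
      rw [map_pow, map_X, map_sum] at h
      rw [← h, eq_sub_iff_add_eq]
      simp only [Finset.smul_sum]
      rw [Finset.sum_comm, ← Finset.sum_add_distrib]
      refine Finset.sum_congr rfl fun j _ => ?_
      rw [unfoldingPoly_eq, map_add, mul_add, map_mul, pderiv_map, deformation, map_sum,
        Finset.mul_sum]
      congr 1
      refine Finset.sum_congr rfl fun l _ => ?_
      rw [← mul_smul_comm, ← Derivation.map_smul, smul_monomial, smul_eq_mul, mul_one]
    rw [h1, map_sub, map_sum, map_sum]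
    simp only [sub_mul, Finset.sum_sub_distrib, map_mul, Finset.sum_mul, smul_mul_assoc]
    congr 1
    rw [Finset.sum_comm]
    refine Finset.sum_congr rfl fun l _ => ?_
    rw [map_smul, ← hG, Finset.smul_sum]
    rfl
  · rw [map_sub, map_sum, specialize_map_C]
    simp [specialize_X_smul]

/-- A functional on `A₋{x}` which kills the relative Jacobian ideal and specializes at `t = 0` to a
homogeneous functional inducing a perfect pairing on the Milnor algebra of `f₀`. -/
theorem FamilyData.exists_functional [Fintype B] (D : FamilyData w d f₀ B m M) :
    ∃ (φ : RelSeries n k →ₗ[Base k] Base k) (φ₀ : MvPolynomial (Fin n) ℂ →ₗ[ℂ] ℂ) (δ : ℤ),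
      (∀ g ∈ relJacobian f₀ m, φ g = 0) ∧
      (∀ α, eval 0 (φ (polyToRel n k (monomial α 1))) = φ₀ (monomial α 1)) ∧
      (∀ p ∈ polyJacobian f₀, φ₀ p = 0) ∧
      (∀ α, φ₀ (monomial α 1) ≠ 0 → (Finsupp.weight w α : ℤ) = δ) ∧
      ∀ z, (∀ α, φ₀ (monomial α 1 * z) = 0) → z ∈ polyJacobian f₀ := by
  classical
  -- The exponent is raised to the weight bound so that the error terms in `exists_rel_matrix` are
  -- heavy enough to be absorbed.
  set M' := weightBound w d M with hM'
  have hM'pos : 0 < M' := Nat.succ_pos _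
  have hpow : ∀ i, (X i ^ M' : MvPolynomial (Fin n) ℂ) ∈ polyJacobian f₀ := fun i => by
    refine Ideal.pow_mem_of_pow_mem _ (D.pow_mem i) ?_
    have h1 : w i ≤ ∑ i, w i :=
      Finset.single_le_sum (f := w) (fun _ _ => Nat.zero_le _) (Finset.mem_univ i)
    have h2 : M ≤ M * ∑ i, w i := Nat.le_mul_of_pos_right _ ((D.weight_pos i).trans_le h1)
    rw [hM', weightBound]
    omega
  have hhom : ∀ i, IsWeightedHomogeneous (intWeight w) (X i ^ M' : MvPolynomial (Fin n) ℂ)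
      ((M' * w i : ℕ) : ℤ) := fun i => by
    rw [X_pow_eq_monomial]
    refine isWeightedHomogeneous_monomial _ _ _ ?_
    rw [weight_intWeight, Finsupp.weight_single, smul_eq_mul]
  obtain ⟨A, hAh, hA⟩ : ∃ A : Matrix (Fin n) (Fin n) (MvPolynomial (Fin n) ℂ),
      (∀ i j, IsWeightedHomogeneous (intWeight w) (A i j) ((M' * w i : ℕ) - (d - w j))) ∧
      ∀ i, X i ^ M' = ∑ j, A i j * pderiv j f₀ := by
    choose A hAh hA using fun i =>
      exists_homogeneous_combination_of_mem D.weight_pos D.homogeneous (hpow i) (hhom i)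
    exact ⟨A, hAh, hA⟩
  obtain ⟨A', hA', hsp⟩ := D.exists_rel_matrix (k := k) (A := A) le_rfl (fun i => (hA i).symm) hAh
  set δ : ℤ := Finsupp.weight w (topExponent n M') -
    (∑ i, ((M' * w i : ℕ) : ℤ) + ∑ j, -((d : ℤ) - w j)) with hδ
  refine ⟨(MvPowerSeries.coeff (topExponent n M')).comp
    ((toSeries n k).toLinearMap.comp (LinearMap.mulLeft (Base k) (Matrix.det A'))),
    topFunctional M' A, δ, fun g hg => ?_, fun α => ?_, fun p hp =>
      topFunctional_eq_zero_of_mem hM'pos (fun i => (hA i).symm) hp, fun α hα => ?_, fun z hz =>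
      mem_polyJacobian_of_topFunctional (fun i => (hA i).symm) hz⟩
  · obtain ⟨c, rfl⟩ := (Submodule.mem_span_range_iff_exists_fun _).1 hg
    rw [map_sum]
    refine Finset.sum_eq_zero fun j _ => ?_
    change MvPowerSeries.coeff _ (toSeries n k (Matrix.det A' * (c j * _))) = 0
    rw [mul_left_comm, det_mul_eq_sum_adjugate A'
      (fun j => polyToRel n k (pderiv j (unfoldingPoly f₀ m))) j, Finset.mul_sum, map_sum, map_sum]
    refine Finset.sum_eq_zero fun i _ => ?_
    rw [show Matrix.mulVec A' (fun j => polyToRel n k (pderiv j (unfoldingPoly f₀ m))) i =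
      polyToRel n k (X i ^ M') from hA' i, ← mul_assoc, map_mul, coe_polyToRel, coe_pow, coe_X,
      coeff_topExponent_mul_X_pow hM'pos]
  · change eval 0 (MvPowerSeries.coeff _ (toSeries n k (Matrix.det A' * _))) = _
    rw [← MvPowerSeries.coeff_map, ← specialize_apply, map_mul, RingHom.map_det,
      topFunctional_apply, ← coeff_coe, coe_mul]
    have h1 : (monomial α 1 : MvPolynomial (Fin n) (Base k)) = map C (monomial α (1 : ℂ)) := by
      rw [map_monomial, C_1]
    rw [h1, specialize_map_C]
    congr 2
    rw [← coeToMvPowerSeries.ringHom_apply, RingHom.map_det]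
    congr 1
    ext1 i j
    exact hsp i j
  · rw [topFunctional_apply] at hα
    have h1 : IsWeightedHomogeneous (intWeight w) (Matrix.det A) _ :=
      isWeightedHomogeneous_det A (fun i => ((M' * w i : ℕ) : ℤ)) (fun j => -((d : ℤ) - w j))
        fun i j => by rw [← sub_eq_add_neg]; exact hAh i j
    have h2 := h1.mul (isWeightedHomogeneous_monomial (intWeight w) α (1 : ℂ)
      (weight_intWeight w α)) hα
    rw [weight_intWeight] at h2
    rw [hδ, h2]
    ring

/-- The Gram matrix at `t = 0` is nondegenerate. -/
theorem FamilyData.det_gram_ne_zero [Fintype B] [DecidableEq B] (D : FamilyData w d f₀ B m M)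
    {φ₀ : MvPolynomial (Fin n) ℂ →ₗ[ℂ] ℂ} (h0 : ∀ p ∈ polyJacobian f₀, φ₀ p = 0)
    (hnd : ∀ z, (∀ α, φ₀ (monomial α 1 * z) = 0) → z ∈ polyJacobian f₀) :
    (Matrix.of fun β γ : B => φ₀ (monomial (β.1 + γ.1) 1)).det ≠ 0 := by
  intro hdet
  obtain ⟨c, hc, hc0⟩ := Matrix.exists_mulVec_eq_zero_iff.2 hdet
  -- A kernel vector gives a combination of basis monomials orthogonal to `B`, hence to every
  -- monomial, because `B` spans modulo the Jacobian ideal.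
  refine hc (D.basis.eq_zero_of_mem c (hnd _ fun α => ?_))
  set z := ∑ α : B, c α • monomial (α : Fin n →₀ ℕ) (1 : ℂ) with hz
  have hB : ∀ β : B, φ₀ (monomial β.1 1 * z) = 0 := fun β => by
    have := congrFun hc0 β
    rw [Matrix.mulVec, dotProduct, Pi.zero_apply] at this
    rw [hz, Finset.mul_sum, map_sum, ← this]
    refine Finset.sum_congr rfl fun γ _ => ?_
    rw [mul_smul_comm, monomial_mul, one_mul, map_smul, smul_eq_mul, mul_comm]
    rfl
  obtain ⟨c', s, -, -, h⟩ := D.basis.exists_division D.weight_pos D.homogeneous α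
  rw [h, add_mul, map_add, Finset.sum_mul, Finset.sum_mul, map_sum, h0, add_zero]
  · refine Finset.sum_eq_zero fun β _ => ?_
    rw [smul_mul_assoc, map_smul, hB, smul_zero]
  · refine Ideal.sum_mem _ fun i _ => Ideal.mul_mem_right _ _ (Ideal.mul_mem_left _ _ ?_)
    exact Ideal.subset_span ⟨i, rfl⟩

/-! ### Freeness of the relative Milnor algebra -/

/-- The class of a polynomial in the relative Milnor algebra. -/
def relClass (f₀ : MvPolynomial (Fin n) ℂ) (m : Fin k → (Fin n →₀ ℕ)) :
    MvPolynomial (Fin n) (Base k) →ₐ[Base k] RelMilnorAlgebra f₀ m :=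
  (Ideal.Quotient.mkₐ (Base k) (relJacobian f₀ m)).comp (polyToRel n k)

theorem relClass_apply (p : MvPolynomial (Fin n) (Base k)) :
    relClass f₀ m p = Ideal.Quotient.mk (relJacobian f₀ m) (polyToRel n k p) := rfl

theorem relClass_eq_iff {p q : MvPolynomial (Fin n) (Base k)} :
    relClass f₀ m p = relClass f₀ m q ↔ polyToRel n k (p - q) ∈ relJacobian f₀ m := by
  rw [relClass_apply, relClass_apply, Ideal.Quotient.eq, map_sub]

theorem relClass_monomial (α : Fin n →₀ ℕ) (a : Base k) :
    relClass f₀ m (monomial α a) = a • relClass f₀ m (monomial α 1) := by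
  rw [← map_smul, smul_monomial, smul_eq_mul, mul_one]

theorem relClass_sum_monomial [Fintype B] (a : B → Base k) :
    relClass f₀ m (∑ α : B, monomial α.1 (a α)) =
      ∑ α : B, a α • relClass f₀ m (monomial α.1 1) := by
  rw [map_sum]
  exact Finset.sum_congr rfl fun α _ => relClass_monomial _ _

theorem relClass_surjective [Fintype B] (D : FamilyData w d f₀ B m M) :
    Function.Surjective (relClass f₀ m) := by
  intro g
  obtain ⟨g, rfl⟩ := Ideal.Quotient.mk_surjective g
  obtain ⟨p, hp⟩ := exists_poly_sub_mem_xIdeal_pow (weightBound w d M) g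
  refine ⟨p, ?_⟩
  rw [relClass_apply, eq_comm, Ideal.Quotient.eq]
  exact smallJacobian_le f₀ m (D.xIdeal_pow_le hp)

/-- The coefficients of a relation form a kernel vector of the Gram matrix. Its determinant is
non-zero in the domain $A_-$, because its value at $t=0$ is the Gram determinant of $f_0$. -/
theorem FamilyData.linearIndependent [Fintype B] (D : FamilyData w d f₀ B m M) :
    LinearIndependent (Base k) fun α : B => relClass f₀ m (monomial α.1 1) := by
  classical
  obtain ⟨φ, φ₀, δ, hφ, hφ₀, h0, -, hnd⟩ := D.exists_functional
  rw [Fintype.linearIndependent_iff]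
  intro a ha
  rw [← relClass_sum_monomial, relClass_apply, Ideal.Quotient.eq_zero_iff_mem] at ha
  have hdet : (Matrix.of fun β γ : B => φ (polyToRel n k (monomial (β.1 + γ.1) 1))).det ≠ 0 := by
    intro h
    refine D.det_gram_ne_zero h0 hnd ?_
    have h' := congrArg (eval (0 : Fin k → ℂ)) h
    rw [map_zero, RingHom.map_det] at h'
    rw [← h']
    congr 1
    ext β γ
    exact (hφ₀ _).symm
  have hmul : Matrix.mulVec
      (Matrix.of fun β γ : B => φ (polyToRel n k (monomial (β.1 + γ.1) 1))) a = 0 := by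
    funext β
    have h := hφ _ (Ideal.mul_mem_left _ (polyToRel n k (monomial β.1 1)) ha)
    rw [← map_mul, Finset.mul_sum, map_sum, map_sum] at h
    rw [Matrix.mulVec, dotProduct, Pi.zero_apply, ← h]
    refine Finset.sum_congr rfl fun γ _ => ?_
    have : (monomial β.1 1 * monomial γ.1 (a γ) : MvPolynomial (Fin n) (Base k)) =
        a γ • monomial (β.1 + γ.1) 1 := by
      rw [monomial_mul, one_mul, smul_monomial, smul_eq_mul, mul_one]
    rw [this, map_smul, map_smul, smul_eq_mul, mul_comm]
    rfl
  by_contra! hne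
  obtain ⟨i, hi⟩ := hne
  exact hdet (Matrix.exists_mulVec_eq_zero_iff.1 ⟨a, fun h => hi (congrFun h i), hmul⟩)

theorem FamilyData.span_eq_top [Fintype B] (D : FamilyData w d f₀ B m M) :
    ⊤ ≤ Submodule.span (Base k) (Set.range fun α : B => relClass f₀ m (monomial α.1 1)) := by
  rintro g -
  obtain ⟨p, rfl⟩ := relClass_surjective D g
  rw [p.as_sum, map_sum]
  refine Submodule.sum_mem _ fun γ _ => ?_
  rw [relClass_monomial]
  refine Submodule.smul_mem _ _ ?_
  obtain ⟨a, -, -, ha⟩ := D.hasNormalForm_monomial (smallJacobian_le f₀ m) γ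
    (Or.inl le_rfl)
  rw [relClass_eq_iff.2 ha, relClass_sum_monomial]
  exact Submodule.sum_mem _ fun α _ => Submodule.smul_mem _ _ (Submodule.subset_span ⟨α, rfl⟩)

/-- The relative Milnor algebra is free over `A₋`, with the monomial basis of the Milnor algebra of
`f₀` as a basis. -/
def FamilyData.relBasis [Fintype B] (D : FamilyData w d f₀ B m M) :
    Module.Basis B (Base k) (RelMilnorAlgebra f₀ m) :=
  Module.Basis.mk D.linearIndependent D.span_eq_top

theorem FamilyData.relBasis_apply [Fintype B] (D : FamilyData w d f₀ B m M) (α : B) :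
    D.relBasis α = relClass f₀ m (monomial α.1 1) := by
  rw [relBasis, Module.Basis.mk_apply]

end Residue

/-! ### The pairing and the dual basis -/

section Pairing

open MvPolynomial

theorem weightedHomogeneousComponent_mul {σ S : Type*} [CommRing S] {v : σ → ℤ}
    {q : MvPolynomial σ S} {e' : ℤ} (hq : IsWeightedHomogeneous v q e') (p : MvPolynomial σ S)
    (e : ℤ) : weightedHomogeneousComponent v (e + e') (p * q) =
      weightedHomogeneousComponent v e p * q := by
  classical
  ext α
  rw [coeff_weightedHomogeneousComponent, coeff_mul, coeff_mul]
  have h : ∀ x ∈ Finset.HasAntidiagonal.antidiagonal α, coeff x.2 q ≠ 0 →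
      (Finsupp.weight v α = e + e' ↔ Finsupp.weight v x.1 = e) := fun x hx hne => by
    rw [← Finset.HasAntidiagonal.mem_antidiagonal.1 hx, map_add, hq hne]
    exact add_left_inj _
  split_ifs with hα
  · refine Finset.sum_congr rfl fun x hx => ?_
    by_cases hne : coeff x.2 q = 0
    · rw [hne, mul_zero, mul_zero]
    · rw [coeff_weightedHomogeneousComponent, if_pos ((h x hx hne).1 hα)]
  · refine (Finset.sum_eq_zero fun x hx => ?_).symm
    by_cases hne : coeff x.2 q = 0
    · rw [hne, mul_zero]
    · rw [coeff_weightedHomogeneousComponent, if_neg fun h' => hα ((h x hx hne).2 h'), zero_mul]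

/-- If all weights are negative, a homogeneous polynomial with non-zero constant term is a
non-zero constant. -/
theorem isUnit_of_isWeightedHomogeneous {k : ℕ} {v : Fin k → ℤ} (hv : ∀ j, v j < 0) {p : Base k}
    {e : ℤ} (hp : IsWeightedHomogeneous v p e) (h0 : eval 0 p ≠ 0) : IsUnit p := by
  classical
  have hc : eval 0 p = coeff 0 p := by
    rw [← constantCoeff_eq, ← eval_zero]
  rw [hc] at h0
  have he : e = 0 := by rw [← hp h0, map_zero]
  have hpC : p = C (coeff 0 p) := by
    ext α
    rw [coeff_C]
    split_ifs with h
    · rw [← h]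
    · by_contra hne
      apply h
      have hα := hp hne
      rw [he, Finsupp.weight_eq_sum] at hα
      ext j
      have hj := (Finset.sum_eq_zero_iff_of_nonpos fun i _ => by
        rw [nsmul_eq_mul]
        exact mul_nonpos_of_nonneg_of_nonpos (by positivity) (hv i).le).1 hα j (Finset.mem_univ j)
      rw [nsmul_eq_mul, mul_eq_zero] at hj
      exact (Nat.cast_eq_zero.1 (hj.resolve_right (hv j).ne)).symm
  rw [hpC]
  exact (IsUnit.mk0 _ h0).map C

variable {n k : ℕ} {w : Fin n → ℕ} {d : ℕ} {f₀ : MvPolynomial (Fin n) ℂ} {B : Set (Fin n →₀ ℕ)}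
  {m : Fin k → (Fin n →₀ ℕ)} {M : ℕ}

theorem FamilyData.exists_normalForm [Fintype B] (D : FamilyData w d f₀ B m M)
    {p : MvPolynomial (Fin n) (Base k)} {e : ℤ} (hp : IsBihom w (tWeight w d m) p e) :
    ∃ a : B → Base k,
      (∀ α : B, IsWeightedHomogeneous (tWeight w d m) (a α) (e - Finsupp.weight w α.1)) ∧
      polyToRel n k (p - ∑ α : B, monomial α.1 (a α)) ∈ relJacobian f₀ m := by
  obtain ⟨a, ha, -, h⟩ := D.hasNormalForm (L := relJacobian f₀ m) (o := 0) (smallJacobian_le f₀ m)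
    hp (fun _ _ => Nat.zero_le _) (Or.inl le_rfl)
  exact ⟨a, ha, h⟩

theorem FamilyData.tWeight_neg (D : FamilyData w d f₀ B m M) (j : Fin k) : tWeight w d m j < 0 := by
  have := D.lt_weight j
  rw [tWeight]
  omega

/-- A homogeneous functional on the relative Milnor algebra inducing a perfect pairing. -/
theorem FamilyData.exists_pairing [Fintype B] [DecidableEq B] (D : FamilyData w d f₀ B m M) :
    ∃ (ψ : RelMilnorAlgebra f₀ m →ₗ[Base k] Base k) (δ : ℤ),
      (∀ p e, IsBihom w (tWeight w d m) p e →
        IsWeightedHomogeneous (tWeight w d m) (ψ (relClass f₀ m p)) (e - δ)) ∧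
      IsUnit (Matrix.of fun β γ : B => ψ (relClass f₀ m (monomial (β.1 + γ.1) 1))).det := by
  obtain ⟨φ, φ₀, δ, hφ, hφ₀, h0, hδ, hnd⟩ := D.exists_functional
  -- `φ` is not known to be homogeneous, as the corrections in its matrix are arbitrary series.
  -- Prescribing the constants $\varphi_0(x^\alpha)$ on the basis gives a homogeneous functional
  -- with the same reduction at $t=0$.
  set ψ : RelMilnorAlgebra f₀ m →ₗ[Base k] Base k :=
    D.relBasis.constr ℂ fun α => C (φ₀ (monomial α.1 1)) with hψdef
  have hψb : ∀ α : B, ψ (relClass f₀ m (monomial α.1 1)) = C (φ₀ (monomial α.1 1)) := fun α => by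
    rw [← D.relBasis_apply, hψdef, Module.Basis.constr_basis]
  have hψ : ∀ (p : MvPolynomial (Fin n) (Base k)) (a : B → Base k),
      polyToRel n k (p - ∑ α : B, monomial α.1 (a α)) ∈ relJacobian f₀ m →
      ψ (relClass f₀ m p) = ∑ α : B, a α * C (φ₀ (monomial α.1 1)) := fun p a ha => by
    rw [relClass_eq_iff.2 ha, relClass_sum_monomial, map_sum]
    refine Finset.sum_congr rfl fun α _ => ?_
    rw [map_smul, hψb, smul_eq_mul]
  have hhom : ∀ p e, IsBihom w (tWeight w d m) p e →
      IsWeightedHomogeneous (tWeight w d m) (ψ (relClass f₀ m p)) (e - δ) := fun p e hp => by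
    obtain ⟨a, ha, h⟩ := D.exists_normalForm hp
    rw [hψ p a h]
    refine IsWeightedHomogeneous.sum _ _ _ fun α _ => ?_
    by_cases hα : φ₀ (monomial α.1 1) = 0
    · rw [hα, C_0, mul_zero]
      exact isWeightedHomogeneous_zero _ _ _
    · have h1 := (ha α).mul (isWeightedHomogeneous_C (tWeight w d m) (φ₀ (monomial α.1 1)))
      rwa [hδ _ hα, add_zero] at h1
  refine ⟨ψ, δ, hhom, ?_⟩
  refine isUnit_of_isWeightedHomogeneous D.tWeight_neg (isWeightedHomogeneous_det _
    (fun β : B => (Finsupp.weight w β.1 : ℤ)) (fun γ : B => Finsupp.weight w γ.1 - δ)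
    fun β γ => ?_) ?_
  · have h1 := hhom _ _ (isBihom_monomial_one (β.1 + γ.1))
    rw [map_add, Nat.cast_add, add_sub_assoc] at h1
    exact h1
  -- At $t=0$ the Gram matrix of `ψ` becomes that of `φ₀`, since `ψ` and `φ` agree there on the
  -- basis and both respect normal forms.
  · rw [RingHom.map_det]
    convert D.det_gram_ne_zero h0 hnd using 3
    ext β γ
    obtain ⟨a, -, h⟩ := D.exists_normalForm
      (isBihom_monomial_one (w := w) (v := tWeight w d m) (β.1 + γ.1))
    change eval 0 (ψ (relClass f₀ m (monomial (β.1 + γ.1) 1))) = φ₀ (monomial (β.1 + γ.1) 1)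
    rw [hψ _ a h, ← hφ₀, map_sum]
    have h1 := hφ _ h
    rw [map_sub, map_sub, sub_eq_zero] at h1
    rw [h1, map_sum, map_sum, map_sum]
    refine Finset.sum_congr rfl fun α _ => ?_
    have : (monomial α.1 (a α) : MvPolynomial (Fin n) (Base k)) = a α • monomial α.1 1 := by
      rw [smul_monomial, smul_eq_mul, mul_one]
    rw [this, map_smul, map_smul, smul_eq_mul, map_mul, map_mul, hφ₀, eval_C]

/-- `ψ` is a functional of degree `-δ` on the relative Milnor algebra, and `N` is the homogeneous basis
dual to the monomial basis `B` for the pairing `(a, b) ↦ ψ (a b)`. -/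
structure DualData [DecidableEq B] (w : Fin n → ℕ) (d : ℕ)
    (ψ : RelMilnorAlgebra f₀ m →ₗ[Base k] Base k) (δ : ℤ)
    (N : B → MvPolynomial (Fin n) (Base k)) : Prop where
  homogeneous : ∀ p e, IsBihom w (tWeight w d m) p e →
    IsWeightedHomogeneous (tWeight w d m) (ψ (relClass f₀ m p)) (e - δ)
  isBihom : ∀ β : B, IsBihom w (tWeight w d m) (N β) (δ - Finsupp.weight w β.1)
  dual : ∀ β γ : B, ψ (relClass f₀ m (N β) * relClass f₀ m (monomial γ.1 1)) =
    if β = γ then 1 else 0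

theorem FamilyData.exists_dualData [Fintype B] [DecidableEq B] (D : FamilyData w d f₀ B m M) :
    ∃ (ψ : RelMilnorAlgebra f₀ m →ₗ[Base k] Base k) (δ : ℤ)
      (N : B → MvPolynomial (Fin n) (Base k)), DualData w d ψ δ N := by
  obtain ⟨ψ, δ, hhom, hdet⟩ := D.exists_pairing
  set G : Matrix B B (Base k) :=
    Matrix.of fun β γ : B => ψ (relClass f₀ m (monomial (β.1 + γ.1) 1)) with hG
  -- The rows of $G^{-1}$ give the dual basis. Taking the component of the expected degree in each
  -- entry ensures homogeneity, and the product with the homogeneous `G` is still the identity.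
  set H : Matrix B B (Base k) := Matrix.of fun β γ => weightedHomogeneousComponent (tWeight w d m)
    (δ - Finsupp.weight w β.1 - Finsupp.weight w γ.1) (G⁻¹ β γ) with hH
  have hGh : ∀ β γ, IsWeightedHomogeneous (tWeight w d m) (G β γ)
      (Finsupp.weight w β.1 + Finsupp.weight w γ.1 - δ) := fun β γ => by
    have := hhom _ _ (isBihom_monomial_one (β.1 + γ.1))
    rw [map_add] at this
    push_cast at this
    exact this
  have hHG : ∀ β γ, ∑ η, H β η * G η γ = if β = γ then 1 else 0 := fun β γ => by
    have h1 : ∀ η, H β η * G η γ = weightedHomogeneousComponent (tWeight w d m)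
        (Finsupp.weight w γ.1 - Finsupp.weight w β.1) (G⁻¹ β η * G η γ) := fun η => by
      rw [hH, Matrix.of_apply, ← weightedHomogeneousComponent_mul (hGh η γ)]
      congr 2
      ring
    simp only [h1]
    rw [← map_sum, ← Matrix.mul_apply, Matrix.nonsing_inv_mul _ hdet, Matrix.one_apply]
    split_ifs with h
    · rw [h, sub_self]
      exact (isWeightedHomogeneous_one _ _).weightedHomogeneousComponent_same
    · rw [map_zero]
  refine ⟨ψ, δ, fun β => ∑ η : B, monomial η.1 (H β η), hhom, fun β => ?_, fun β γ => ?_⟩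
  · refine IsBihom.sum _ _ fun η _ => isBihom_monomial
      (weightedHomogeneousComponent_isWeightedHomogeneous _ _) _ ?_
    ring
  · rw [← hHG, relClass_sum_monomial, Finset.sum_mul, map_sum]
    refine Finset.sum_congr rfl fun η _ => ?_
    rw [smul_mul_assoc, map_smul, ← map_mul, monomial_mul, one_mul, smul_eq_mul]
    rfl

namespace DualData

variable [Fintype B] [DecidableEq B] {ψ : RelMilnorAlgebra f₀ m →ₗ[Base k] Base k} {δ : ℤ}
  {N : B → MvPolynomial (Fin n) (Base k)}

theorem apply_sum_mul (E : DualData w d ψ δ N) (c : B → Base k) (β : B) :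
    ψ ((∑ γ : B, c γ • relClass f₀ m (monomial γ.1 1)) * relClass f₀ m (N β)) = c β := by
  rw [Finset.sum_mul, map_sum, Finset.sum_eq_single β]
  · rw [smul_mul_assoc, map_smul, mul_comm, E.dual, if_pos rfl, smul_eq_mul, mul_one]
  · intro γ _ hγ
    rw [smul_mul_assoc, map_smul, mul_comm, E.dual, if_neg hγ.symm, smul_zero]
  · simp

/-- Expansion in the monomial basis. -/
theorem eq_sum_monomial (E : DualData w d ψ δ N) (D : FamilyData w d f₀ B m M)
    (g : RelMilnorAlgebra f₀ m) :
    g = ∑ γ : B, ψ (g * relClass f₀ m (N γ)) • relClass f₀ m (monomial γ.1 1) := by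
  have h : g = ∑ γ : B, D.relBasis.repr g γ • relClass f₀ m (monomial γ.1 1) := by
    conv_lhs => rw [← D.relBasis.sum_repr g]
    exact Finset.sum_congr rfl fun γ _ => by rw [D.relBasis_apply]
  have hc : ∀ γ, ψ (g * relClass f₀ m (N γ)) = D.relBasis.repr g γ := fun γ => by
    conv_lhs => rw [h]
    exact E.apply_sum_mul _ γ
  simp only [hc]
  exact h

/-- Expansion in the dual basis. -/
theorem eq_sum_dual (E : DualData w d ψ δ N) (D : FamilyData w d f₀ B m M)
    (g : RelMilnorAlgebra f₀ m) :
    g = ∑ β : B, ψ (g * relClass f₀ m (monomial β.1 1)) • relClass f₀ m (N β) := by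
  rw [← sub_eq_zero]
  set x := g - ∑ β : B, ψ (g * relClass f₀ m (monomial β.1 1)) • relClass f₀ m (N β) with hx
  have h1 : ∀ γ : B, ψ (x * relClass f₀ m (monomial γ.1 1)) = 0 := fun γ => by
    rw [hx, sub_mul, map_sub, Finset.sum_mul, map_sum, Finset.sum_eq_single γ]
    · rw [smul_mul_assoc, map_smul, E.dual, if_pos rfl, smul_eq_mul, mul_one, sub_self]
    · intro β _ hβ
      rw [smul_mul_assoc, map_smul, E.dual, if_neg hβ, smul_zero]
    · simp
  have h2 : ∀ y, ψ (x * y) = 0 := fun y => by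
    rw [E.eq_sum_monomial D y, Finset.mul_sum, map_sum]
    refine Finset.sum_eq_zero fun γ _ => ?_
    rw [mul_smul_comm, map_smul, h1, smul_zero]
  rw [E.eq_sum_monomial D x]
  exact Finset.sum_eq_zero fun γ _ => by rw [h2, zero_smul]

end DualData

/-! ### Multiples of `F` in the relative Milnor algebra -/

/-- By Euler's identity the class of `F` is represented by a polynomial all of whose monomials have
weight `> d`. -/
theorem FamilyData.exists_euler (D : FamilyData w d f₀ B m M) :
    ∃ q : MvPolynomial (Fin n) (Base k), IsBihom w (tWeight w d m) q d ∧
      (∀ α, coeff α q ≠ 0 → d < Finsupp.weight w α) ∧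
      relClass f₀ m (unfoldingPoly f₀ m) = relClass f₀ m q := by
  classical
  -- Euler's identity reads $\sum_iw_ix_i\,\partial_iF=dF-\sum_j(d-\deg m_j)\,t_jm_j$, whence these
  -- coefficients after division by `d`.
  set a : Fin k → ℂ := fun j => ((d : ℂ) - Finsupp.weight w (m j)) / d with ha
  have hd : (d : ℂ) ≠ 0 := Nat.cast_ne_zero.2 D.degree_ne_zero
  refine ⟨∑ j, monomial (m j) (C (a j) * X j), IsBihom.sum _ _ fun j _ => ?_, fun α hα => ?_, ?_⟩
  · refine isBihom_monomial ((isWeightedHomogeneous_X _ _ j).C_mul _) _ ?_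
    simp [tWeight]
  · rw [coeff_sum] at hα
    obtain ⟨j, _, hj⟩ := Finset.exists_ne_zero_of_sum_ne_zero hα
    rw [coeff_monomial] at hj
    have : m j = α := by
      by_contra h
      exact hj (if_neg h)
    rw [← this]
    exact D.lt_weight j
  · rw [relClass_eq_iff]
    have hf : IsWeightedHomogeneous w (map C f₀ : MvPolynomial (Fin n) (Base k)) d := by
      intro α hα
      rw [coeff_map] at hα
      exact D.homogeneous fun h => hα (by rw [h, C_0])
    have h1 := hf.sum_weight_X_mul_pderiv
    have h2 : ∀ j, ∑ i, w i • (X i * pderiv i (monomial (m j) (X j : Base k))) =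
        Finsupp.weight w (m j) • monomial (m j) (X j : Base k) := fun j =>
      (isWeightedHomogeneous_monomial w (m j) (X j : Base k) rfl).sum_weight_X_mul_pderiv
    have h3 : ∑ i, w i • (X i * pderiv i (unfoldingPoly f₀ m)) =
        d • (unfoldingPoly f₀ m - ∑ j, monomial (m j) (C (a j) * X j)) := by
      simp only [unfoldingPoly_eq, deformation, map_add, map_sum, mul_add, smul_add,
        Finset.sum_add_distrib, Finset.mul_sum, Finset.smul_sum, h1, smul_sub]
      rw [Finset.sum_comm]
      simp only [h2]
      rw [add_sub_assoc, ← Finset.sum_sub_distrib]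
      congr 1
      refine Finset.sum_congr rfl fun j _ => ?_
      rw [← map_nsmul, ← map_nsmul, ← map_nsmul, ← map_sub]
      congr 1
      have : C (a j) * (d : Base k) = (d : Base k) - (Finsupp.weight w (m j) : Base k) := by
        rw [← map_natCast (C : ℂ →+* Base k) d, ← map_mul, ha, div_mul_cancel₀ _ hd, map_sub]
        simp
      simp only [nsmul_eq_mul]
      linear_combination (X j : Base k) * this
    have h4 : polyToRel n k (d • (unfoldingPoly f₀ m - ∑ j, monomial (m j) (C (a j) * X j))) ∈
        relJacobian f₀ m := by
      rw [← h3, map_sum]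
      refine Ideal.sum_mem _ fun i _ => ?_
      rw [map_nsmul, map_mul]
      exact nsmul_mem (Ideal.mul_mem_left _ _ (polyToRel_pderiv_mem i)) _
    have h5 : unfoldingPoly f₀ m - ∑ j, monomial (m j) (C (a j) * X j) =
        (C (d : ℂ)⁻¹ : Base k) •
          (d • (unfoldingPoly f₀ m - ∑ j, monomial (m j) (C (a j) * X j))) := by
      rw [← Nat.cast_smul_eq_nsmul (Base k) d, smul_smul, ← map_natCast (C : ℂ →+* Base k) d,
        ← map_mul, inv_mul_cancel₀ hd, C_1, one_smul]
    rw [h5, map_smul]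
    exact Submodule.smul_of_tower_mem _ _ h4

theorem FamilyData.le_weight_of_unfoldingPoly (D : FamilyData w d f₀ B m M) {α : Fin n →₀ ℕ}
    (hα : coeff α (unfoldingPoly f₀ m) ≠ 0) : d ≤ Finsupp.weight w α := by
  rw [unfoldingPoly_eq, coeff_add] at hα
  by_cases h : coeff α (deformation m) = 0
  · rw [h, add_zero, coeff_map] at hα
    exact (D.homogeneous fun h => hα (by rw [h, C_0])).ge
  · exact (D.lt_weight_of_deformation h).le

/-- The index of an upper monomial in the monomial basis. -/
def FamilyData.index (D : FamilyData w d f₀ B m M) (j : Fin k) : B := ⟨m j, D.mem_basis j⟩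

theorem FamilyData.index_injective (D : FamilyData w d f₀ B m M) :
    Function.Injective D.index := fun _ _ h => D.upper.injective (congrArg Subtype.val h)

theorem FamilyData.weight_le_of_notMem (D : FamilyData w d f₀ B m M) {γ : B}
    (hγ : γ ∉ Set.range D.index) : Finsupp.weight w γ.1 ≤ d := by
  by_contra h
  have : γ.1 ∈ Set.range m := by
    rw [D.upper.range_eq]
    exact ⟨γ.2, not_le.1 h⟩
  obtain ⟨j, hj⟩ := this
  exact hγ ⟨j, Subtype.ext hj⟩

/-- The matrix of the pairing of multiples of `F`. -/
def coeffMatrix (D : FamilyData w d f₀ B m M) (ψ : RelMilnorAlgebra f₀ m →ₗ[Base k] Base k)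
    (N : B → MvPolynomial (Fin n) (Base k)) (i j : Fin k) : Base k :=
  ψ (relClass f₀ m (N (D.index i.rev)) * relClass f₀ m (unfoldingPoly f₀ m) *
    relClass f₀ m (N (D.index j)))

/-- The pairing is symmetric in its two dual basis elements; reversing the first index turns
symmetry about the diagonal into symmetry about the antidiagonal. -/
theorem coeffMatrix_symm (D : FamilyData w d f₀ B m M)
    (ψ : RelMilnorAlgebra f₀ m →ₗ[Base k] Base k) (N : B → MvPolynomial (Fin n) (Base k)) (i j : Fin k) :
    coeffMatrix D ψ N i j = coeffMatrix D ψ N j.rev i.rev := by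
  rw [coeffMatrix, coeffMatrix, Fin.rev_rev, mul_right_comm,
    mul_comm (relClass f₀ m (N (D.index i.rev))), mul_right_comm]

theorem DualData.isWeightedHomogeneous_coeffMatrix [DecidableEq B]
    {ψ : RelMilnorAlgebra f₀ m →ₗ[Base k] Base k} {δ : ℤ} {N : B → MvPolynomial (Fin n) (Base k)}
    (E : DualData w d ψ δ N) (D : FamilyData w d f₀ B m M)
    (i j : Fin k) : IsWeightedHomogeneous (tWeight w d m) (coeffMatrix D ψ N i j)
      (tWeight w d m j + (δ - Finsupp.weight w (m i.rev))) := by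
  rw [coeffMatrix, ← map_mul, ← map_mul]
  convert E.homogeneous _ _ (((E.isBihom (D.index i.rev)).mul D.isBihom_unfoldingPoly).mul
    (E.isBihom (D.index j))) using 1
  simp only [tWeight, FamilyData.index]
  ring

namespace DualData

variable [Fintype B] [DecidableEq B] {ψ : RelMilnorAlgebra f₀ m →ₗ[Base k] Base k} {δ : ℤ}
  {N : B → MvPolynomial (Fin n) (Base k)}

/-- Homogeneous multiples of `F` have no components outside the upper monomials. -/
theorem apply_mul_unfolding (E : DualData w d ψ δ N) (D : FamilyData w d f₀ B m M)
    {p : MvPolynomial (Fin n) (Base k)} {e : ℤ} (hp : IsBihom w (tWeight w d m) p e) {γ : B}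
    (hγ : Finsupp.weight w γ.1 ≤ d) :
    ψ (relClass f₀ m p * relClass f₀ m (unfoldingPoly f₀ m) * relClass f₀ m (N γ)) = 0 := by
  obtain ⟨q, hq, hqd, hFq⟩ := D.exists_euler
  -- The strict inequality in the Euler representative permits the threshold `d + 1`, which excludes
  -- $x^\gamma$ from the normal form.
  obtain ⟨a, -, ha, h⟩ := D.hasNormalForm (o := d + 1) (smallJacobian_le f₀ m) (hp.mul hq)
    (fun α hα => by
      obtain ⟨β, η, rfl, -, hη⟩ := coeff_mul_ne_zero_imp hα
      have := hqd η hη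
      rw [map_add]
      omega) (Or.inl le_rfl)
  rw [hFq, ← map_mul, relClass_eq_iff.2 h, relClass_sum_monomial, E.apply_sum_mul]
  by_contra hne
  have := ha γ hne
  omega

theorem mul_unfolding_eq (E : DualData w d ψ δ N) (D : FamilyData w d f₀ B m M) (i : Fin k) :
    relClass f₀ m (N (D.index i.rev)) * relClass f₀ m (unfoldingPoly f₀ m) =
      ∑ j, coeffMatrix D ψ N i j • relClass f₀ m (monomial (m j) 1) := by
  rw [E.eq_sum_monomial D (relClass f₀ m (N (D.index i.rev)) * relClass f₀ m (unfoldingPoly f₀ m))]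
  refine (Fintype.sum_of_injective D.index D.index_injective _ _ (fun γ hγ => ?_)
    fun j => rfl).symm
  rw [E.apply_mul_unfolding D (E.isBihom _) (D.weight_le_of_notMem hγ), zero_smul]

/-- By commutativity the coefficient of $x^\gamma$ in $N_\beta F$ is that of $x^\beta$ in $N_\gamma
F$, which vanishes because $x^\beta$ is not upper. -/
theorem mul_unfolding_eq_zero (E : DualData w d ψ δ N) (D : FamilyData w d f₀ B m M) {β : B}
    (hβ : β ∉ Set.range D.index) :
    relClass f₀ m (N β) * relClass f₀ m (unfoldingPoly f₀ m) = 0 := by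
  rw [E.eq_sum_monomial D (relClass f₀ m (N β) * relClass f₀ m (unfoldingPoly f₀ m))]
  refine Finset.sum_eq_zero fun γ _ => ?_
  rw [mul_assoc, mul_comm, mul_comm (relClass f₀ m (unfoldingPoly f₀ m)),
    E.apply_mul_unfolding D (E.isBihom _) (D.weight_le_of_notMem hβ), zero_smul]

/-- The equation `n_i F = ∑ h_{ij} m_j` holds modulo `(x) (∂F/∂x₁, …, ∂F/∂xₙ)`. -/
theorem polyToRel_sub_mem (E : DualData w d ψ δ N) (D : FamilyData w d f₀ B m M) (i : Fin k) :
    polyToRel n k (N (D.index i.rev) * unfoldingPoly f₀ m) -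
      ∑ j, coeffMatrix D ψ N i j • upperMonomial m j ∈ smallJacobian f₀ m := by
  -- The Euler representative is congruent to `F` only modulo $J_F$, so here `F` itself is divided;
  -- its monomials reach the weight `d` needed to stay modulo $(x)J_F$.
  obtain ⟨a, -, -, h⟩ := D.hasNormalForm (L := smallJacobian f₀ m) (o := d) le_rfl
    ((E.isBihom (D.index i.rev)).mul D.isBihom_unfoldingPoly)
    (fun α hα => by
      obtain ⟨β, η, rfl, -, hη⟩ := coeff_mul_ne_zero_imp hα
      have := D.le_weight_of_unfoldingPoly hη
      rw [map_add]
      omega) (Or.inr le_rfl)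
  have h1 := relClass_eq_iff.2 (smallJacobian_le f₀ m h)
  rw [relClass_sum_monomial, map_mul] at h1
  -- Reduced modulo $J_F$, this finer normal form must coincide with the expansion in the basis of
  -- $I$.
  have ha : ∀ γ, a γ = ψ (relClass f₀ m (N (D.index i.rev)) *
      relClass f₀ m (unfoldingPoly f₀ m) * relClass f₀ m (N γ)) := fun γ => by
    rw [h1, E.apply_sum_mul]
  have h2 : ∑ α : B, (monomial α.1 (a α) : MvPolynomial (Fin n) (Base k)) =
      ∑ j, coeffMatrix D ψ N i j • monomial (m j) 1 := by
    refine (Fintype.sum_of_injective D.index D.index_injective _ _ (fun γ hγ => ?_)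
      fun j => ?_).symm
    · rw [ha, E.apply_mul_unfolding D (E.isBihom _) (D.weight_le_of_notMem hγ), map_zero]
    · rw [ha, smul_monomial, smul_eq_mul, mul_one]
      rfl
  rw [h2, map_sub, map_sum] at h
  simp only [map_smul] at h
  exact h

end DualData

end Pairing

/-! ### The kernel of the Kodaira–Spencer map -/

section Kernel

open MvPolynomial

variable {n k : ℕ} {w : Fin n → ℕ} {d : ℕ} {f₀ : MvPolynomial (Fin n) ℂ} {B : Set (Fin n →₀ ℕ)}
  {m : Fin k → (Fin n →₀ ℕ)} {M : ℕ}

theorem derivation_sum_apply {ι : Type*} (s : Finset ι) (θ : ι → Derivation ℂ (Base k) (Base k))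
    (p : Base k) : (∑ i ∈ s, θ i) p = ∑ i ∈ s, θ i p := by
  have h := map_sum (Derivation.coeFnAddMonoidHom (R := ℂ) (A := Base k) (M := Base k)) θ s
  exact (congrFun h p).trans (Finset.sum_apply _ _ _)

theorem vectorField_X (h : Fin k → Base k) (j : Fin k) : vectorField h (X j) = h j := by
  classical
  rw [vectorField, derivation_sum_apply, Finset.sum_eq_single j]
  · simp
  · intro i _ hij
    simp [pderiv_X_of_ne hij.symm]
  · simp

theorem isHomogeneousField_vectorField {v : Fin k → ℤ} {h : Fin k → Base k} {e : ℤ}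
    (hh : ∀ j, IsWeightedHomogeneous v (h j) (v j + e)) : IsHomogeneousField v (vectorField h) e := by
  intro p a hp
  rw [vectorField, derivation_sum_apply]
  refine IsWeightedHomogeneous.sum _ _ _ fun j _ => ?_
  have h1 := (hh j).mul (hp.pderiv (i := j) (sub_add_cancel a (v j)))
  rwa [add_comm (v j), add_add_sub_cancel, add_comm e] at h1

theorem mem_ker_kodairaSpencer (hm : ∀ j, m j ≠ 0) (δ : Derivation ℂ (Base k) (Base k)) :
    δ ∈ LinearMap.ker (kodairaSpencer f₀ m hm) ↔ derivUnfolding m δ ∈ ksIdeal f₀ m := by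
  rw [LinearMap.mem_ker]
  exact Submodule.Quotient.mk_eq_zero _

theorem relClass_eq_mk_unfolding :
    relClass f₀ m (unfoldingPoly f₀ m) = Ideal.Quotient.mk (relJacobian f₀ m) (unfolding f₀ m) := rfl

theorem FamilyData.linearIndependent_upper [Fintype B] (D : FamilyData w d f₀ B m M) :
    LinearIndependent (Base k) fun j => relClass f₀ m (monomial (m j) 1) :=
  D.linearIndependent.comp D.index D.index_injective

theorem FamilyData.eq_of_sum_eq [Fintype B] (D : FamilyData w d f₀ B m M) {a b : Fin k → Base k}
    (h : ∑ j, a j • relClass f₀ m (monomial (m j) 1) =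
      ∑ j, b j • relClass f₀ m (monomial (m j) 1)) : a = b := by
  funext j
  have := Fintype.linearIndependent_iff.1 D.linearIndependent_upper (fun j => a j - b j) (by
    simp only [sub_smul, Finset.sum_sub_distrib]
    rw [h, sub_self]) j
  exact sub_eq_zero.1 this

/-- If $\theta F\equiv gF$ in $I$, expand $g$ in the dual basis: only the $N_\beta$ with $x^\beta$
upper survive multiplication by $F$, and comparing coefficients of the $m_j$ expresses $\theta$
through the fields $\delta_i$. The reverse inclusion is the congruence modulo $(x)J_F$ from
`polyToRel_sub_mem`. -/
theorem DualData.ker_kodairaSpencer [Fintype B] [DecidableEq B]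
    {ψ : RelMilnorAlgebra f₀ m →ₗ[Base k] Base k} {δ : ℤ} {N : B → MvPolynomial (Fin n) (Base k)}
    (E : DualData w d ψ δ N) (D : FamilyData w d f₀ B m M) (hm : ∀ j, m j ≠ 0) :
    LinearMap.ker (kodairaSpencer f₀ m hm) = Submodule.span (Base k)
      (Set.range fun i => vectorField (coeffMatrix D ψ N i)) := by
  apply le_antisymm
  · intro θ hθ
    rw [mem_ker_kodairaSpencer, ksIdeal] at hθ
    obtain ⟨g, hg, q, hq, hgq⟩ := Submodule.mem_sup.1 hθ
    obtain ⟨g, rfl⟩ := Ideal.mem_span_singleton'.1 hg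
    have hq' : q ∈ relJacobian f₀ m := smallJacobian_le f₀ m hq
    have h1 : ∑ j, θ (X j) • relClass f₀ m (monomial (m j) 1) =
        Ideal.Quotient.mk (relJacobian f₀ m) g * relClass f₀ m (unfoldingPoly f₀ m) := by
      rw [relClass_eq_mk_unfolding, ← map_mul, eq_comm, ← sub_eq_zero]
      have h2 : ∑ j, θ (X j) • relClass f₀ m (monomial (m j) 1) =
          Ideal.Quotient.mk (relJacobian f₀ m) (derivUnfolding m θ) := by
        change _ = Ideal.Quotient.mkₐ (Base k) (relJacobian f₀ m)
          (∑ j, θ (X j) • upperMonomial m j)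
        rw [map_sum]
        refine Finset.sum_congr rfl fun j _ => ?_
        rw [map_smul]
        rfl
      rw [h2, ← map_sub, Ideal.Quotient.eq_zero_iff_mem, ← hgq, sub_add_cancel_left]
      exact neg_mem hq'
    set c : B → Base k := fun β =>
      ψ (Ideal.Quotient.mk (relJacobian f₀ m) g * relClass f₀ m (monomial β.1 1)) with hc
    have h3 : Ideal.Quotient.mk (relJacobian f₀ m) g * relClass f₀ m (unfoldingPoly f₀ m) =
        ∑ j, (∑ i, c (D.index i.rev) * coeffMatrix D ψ N i j) •
          relClass f₀ m (monomial (m j) 1) := by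
      have h4 : ∑ β : B, c β • (relClass f₀ m (N β) * relClass f₀ m (unfoldingPoly f₀ m)) =
          ∑ i : Fin k, c (D.index i.rev) •
            (relClass f₀ m (N (D.index i.rev)) * relClass f₀ m (unfoldingPoly f₀ m)) := by
        refine (Fintype.sum_of_injective (fun i : Fin k => D.index i.rev)
          (D.index_injective.comp Fin.rev_injective) _ _ (fun β hβ => ?_) fun i => rfl).symm
        rw [E.mul_unfolding_eq_zero D, smul_zero]
        rintro ⟨j, rfl⟩
        exact hβ ⟨j.rev, by simp only [Fin.rev_rev]⟩
      rw [E.eq_sum_dual D (Ideal.Quotient.mk (relJacobian f₀ m) g), Finset.sum_mul]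
      simp only [smul_mul_assoc]
      refine h4.trans ?_
      simp only [E.mul_unfolding_eq D, Finset.smul_sum, smul_smul, Finset.sum_smul]
      exact Finset.sum_comm
    have h5 := D.eq_of_sum_eq (h1.trans h3)
    have h6 : θ = ∑ i, c (D.index i.rev) • vectorField (coeffMatrix D ψ N i) := by
      refine MvPolynomial.derivation_ext fun j => ?_
      rw [congrFun h5 j, derivation_sum_apply]
      refine Finset.sum_congr rfl fun i _ => ?_
      rw [Derivation.smul_apply, vectorField_X, smul_eq_mul]
    rw [h6]
    exact Submodule.sum_mem _ fun i _ => Submodule.smul_mem _ _ (Submodule.subset_span ⟨i, rfl⟩)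
  · rw [Submodule.span_le]
    rintro _ ⟨i, rfl⟩
    rw [SetLike.mem_coe, mem_ker_kodairaSpencer]
    have h1 : derivUnfolding m (vectorField (coeffMatrix D ψ N i)) =
        ∑ j, coeffMatrix D ψ N i j • upperMonomial m j := by
      change ∑ j, vectorField (coeffMatrix D ψ N i) (X j) • upperMonomial m j = _
      simp only [vectorField_X]
    rw [h1]
    have h2 : ∑ j, coeffMatrix D ψ N i j • upperMonomial m j =
        polyToRel n k (N (D.index i.rev)) * unfolding f₀ m -
          (polyToRel n k (N (D.index i.rev) * unfoldingPoly f₀ m) -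
            ∑ j, coeffMatrix D ψ N i j • upperMonomial m j) := by
      rw [map_mul, unfolding, sub_sub_cancel]
    rw [h2, ksIdeal]
    exact Ideal.sub_mem _ (Ideal.mem_sup_left (Ideal.mul_mem_left _ _
      (Ideal.mem_span_singleton_self _))) (Ideal.mem_sup_right (E.polyToRel_sub_mem D i))

theorem DualData.polyToRel_ne_zero [DecidableEq B] {ψ : RelMilnorAlgebra f₀ m →ₗ[Base k] Base k}
    {δ : ℤ} {N : B → MvPolynomial (Fin n) (Base k)} (E : DualData w d ψ δ N) (β : B) :
    polyToRel n k (N β) ≠ 0 := by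
  intro h
  have h1 := E.dual β β
  rw [relClass_apply, h, map_zero, zero_mul, map_zero, if_pos rfl] at h1
  exact zero_ne_one h1

end Kernel

end SemiQH

end

/-! ### Assembly of the theorem -/

open SemiQH

theorem proposition3p2 {n k : ℕ} (w : Fin n → ℕ) (hw : ∀ i, 0 < w i) (d : ℕ)
    (f₀ : MvPolynomial (Fin n) ℂ) (hf₀ : MvPolynomial.IsWeightedHomogeneous w f₀ d)
    (hsing : HasIsolatedSingularity f₀)
    (B : Set (Fin n →₀ ℕ)) (hB : IsMonomialBasis f₀ B)
    (m : Fin k → (Fin n →₀ ℕ)) (hm : EnumeratesUpper w d B m) :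
    ∃ (N : Fin k → RelSeries n k) (e : Fin k → ℤ),
      (∀ i, N i ≠ 0 ∧ IsHomogeneousSeries w (tWeight w d m) (N i) (e i)) ∧
      (∃! h : Fin k → Fin k → Base k, IsCoeffMatrix f₀ m N h) ∧
      ∀ h : Fin k → Fin k → Base k, IsCoeffMatrix f₀ m N h →
        (∀ i j, h i j = h j.rev i.rev) ∧
        (∀ i, IsHomogeneousField (tWeight w d m) (vectorField (h i)) (e i)) ∧
        LinearMap.ker (kodairaSpencer f₀ m hm.ne_zero) =
          Submodule.span (Base k) (Set.range fun i => vectorField (h i)) := by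
  classical
  -- Without upper monomials there may be no variables at all and `d = 0` is possible; but then
  -- $\operatorname{Der}_{\mathbb C}A_-=0$.
  rcases isEmpty_or_nonempty (Fin k) with hk | ⟨⟨j₀⟩⟩
  · refine ⟨isEmptyElim, isEmptyElim, isEmptyElim, ⟨isEmptyElim, isEmptyElim, fun h _ =>
      Subsingleton.elim _ _⟩, fun h _ => ⟨isEmptyElim, isEmptyElim, ?_⟩⟩
    have : Subsingleton (Derivation ℂ (Base k) (Base k)) :=
      ⟨fun θ θ' => MvPolynomial.derivation_ext isEmptyElim⟩
    exact Subsingleton.elim _ _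
  -- An upper monomial is not constant, so it supplies a variable; this yields `d ≠ 0`, which
  -- Euler's identity needs.
  obtain ⟨i₀, -⟩ := Finsupp.ne_iff.1 (hm.ne_zero j₀)
  obtain ⟨M, hpow⟩ := exists_X_pow_mem_polyJacobian hw hf₀ hsing
  have D : FamilyData w d f₀ B m M :=
    ⟨hw, degree_ne_zero hw hf₀ hsing i₀, hf₀, hB, hm, hpow⟩
  have : Fintype B := (hB.finite hpow).fintype
  obtain ⟨ψ, δ, N, E⟩ := D.exists_dualData
  have huniq : ∀ h, IsCoeffMatrix f₀ m (fun i => polyToRel n k (N (D.index i.rev))) h ↔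
      h = coeffMatrix D ψ N := by
    intro h
    have hiff : IsCoeffMatrix f₀ m (fun i => polyToRel n k (N (D.index i.rev))) h ↔
        ∀ i, relClass f₀ m (N (D.index i.rev)) * relClass f₀ m (unfoldingPoly f₀ m) =
          ∑ j, h i j • relClass f₀ m (MvPolynomial.monomial (m j) 1) := Iff.rfl
    rw [hiff]
    constructor
    · intro hh
      funext i
      exact D.eq_of_sum_eq ((hh i).symm.trans (E.mul_unfolding_eq D i))
    · rintro rfl
      exact E.mul_unfolding_eq D
  refine ⟨fun i => polyToRel n k (N (D.index i.rev)), fun i => δ - Finsupp.weight w (m i.rev),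
    fun i => ⟨E.polyToRel_ne_zero _, (E.isBihom _).isHomogeneousSeries⟩,
    ⟨coeffMatrix D ψ N, (huniq _).2 rfl, fun h hh => (huniq h).1 hh⟩, fun h hh => ?_⟩
  rw [(huniq h).1 hh]
  exact ⟨coeffMatrix_symm D ψ N, fun i =>
    isHomogeneousField_vectorField (E.isWeightedHomogeneous_coeffMatrix D i),
    E.ker_kodairaSpencer D _⟩
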